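/- Let $(M,g)$ be a nonempty smooth Riemannian manifold of dimension $n\ge 2$. For $y\in TM$ let $t=\tfrac12 g(y,y)$ be its energy density, and let $X^H_y$, $X^V_y$ be the horizontal (with respect to the Levi-Civita connection of $g$) and vertical lifts at $y$ of a tangent vector $X$ of $M$ at the base point of $y$. Let $0<T\le\infty$, let $a_1,a_2,b_1,b_2,c_1,c_2,d_1,d_2$ be smooth functions of $t\in[0,T)$, and suppose that on the tube $\{t<T\}\subseteq TM$ (all of $TM$ if $T=\infty$) the formulas $$JX^H_y=a_1(t)X^V_y+b_1(t)g(X,y)\,y^V_y,\qquad JX^V_y=-a_2(t)X^H_y-b_2(t)g(X,y)\,y^H_y,$$ $$G(X^H_y,Y^H_y)=c_1(t)g(X,Y)+d_1(t)g(X,y)g(Y,y),\quad G(X^V_y,Y^V_y)=c_2(t)g(X,Y)+d_2(t)g(X,y)g(Y,y),\quad G(X^V_y,Y^H_y)=0$$ define an almost complex structure $J$ and a nondegenerate metric $G$ with $G(JX,JY)=-G(X,Y)$ (a natural diagonal almost anti-Hermitian structure on the tube). It is called anti-Kähler if $\nabla J=0$ for the Levi-Civita connection $\nabla$ of $G$,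 and $J$ is called integrable if its Nijenhuis tensor vanishes. **Theorem.** The structure $(G,J)$ is anti-Kähler on the tube if and only if one of the following holds. 1. $J$ is integrable and, for some constant $c$, $M$ has constant sectional curvature $c$ and on $[0,T)$ $$b_1=\frac{a_1a_1'-c}{a_1-2ta_1'},\qquad c_1'=\frac{2cc_1(a_1-2a_1't)}{a_1(a_1^2-2ct)},\qquad d_1=c\,c_2=-c\,\frac{c_1}{a_1^2},\qquad a_1^2\ne 2ct,\quad a_1\neq 2ta_1'.$$ 2. $M$ has constant sectional curvature $c$ for some constant $c$, and there are constants $A\ne0$ and $B>0$ such that on $[0,T)$ $$a_1=\sqrt{B+2ct},\qquad b_1=0,\qquad c_1=A(B+2ct),\qquad d_1=-cA.$$ Here $J$ is integrable on the tube if and only if $M$ has constant sectional curvature $c$ for some constant $c$ with $b_1=\frac{a_1a_1'-c}{a_1-2ta_1'}$ (and $a_1\ne 2ta_1'$) on $[0,T)$. Moreover, if $M$ has constant sectional curvature $c$, and $A\ne 0$, $B>0$ and $0<T\le\infty$ are given, then a natural diagonal anti-Kähler structure with coefficients $a_1,b_1,c_1,d_1$ as in case 2 exists on the tube $\{t<T\}$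 if and only if $c\ge0$ or $T\le-\frac{B}{2c}$. So for $c\ge0$ the structure of case 2 is defined on all of $TM$, and for $c<0$ only on the tube $t<-\frac{B}{2c}$ around the zero section. -/

import Mathlib

open scoped Manifold ContDiff

set_option maxSynthPendingDepth 3

noncomputable section

namespace AntiKahler

/-! ## Local differential geometry on an open subset of a normed space

A metric is given by its coordinate expression `h : V → V →L[ℝ] V →L[ℝ] ℝ`, where `V` is the
coordinate space. -/

section LocalGeometry

variable {V : Type*} [NormedAddCommGroup V] [NormedSpace ℝ V]

/-- Christoffel symbols of the first kind:
`(u, v, w) ↦ (∂_u h(v, w) + ∂_v h(u, w) - ∂_w h(u, v)) / 2`. -/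
def christoffelFirst (h : V → V →L[ℝ] V →L[ℝ] ℝ) (x : V) : V →L[ℝ] V →L[ℝ] V →L[ℝ] ℝ :=
  (1 / 2 : ℝ) • (fderiv ℝ h x + (fderiv ℝ h x).flip
    - (ContinuousLinearMap.flipₗᵢ ℝ V V ℝ).toContinuousLinearEquiv.toContinuousLinearMap
        ∘L (fderiv ℝ h x).flip)

theorem christoffelFirst_apply (h : V → V →L[ℝ] V →L[ℝ] ℝ) (x u v w : V) :
    christoffelFirst h x u v w =
      (fderiv ℝ h x u v w + fderiv ℝ h x v u w - fderiv ℝ h x w u v) / 2 := by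
  simp [christoffelFirst]
  ring

/-- Christoffel symbols of the second kind (the Levi-Civita connection of `h` in coordinates):
`Γ(u, v)` is the vector with `h(Γ(u, v), w) = christoffelFirst h x u v w` for all `w`.
The inverse is the true one wherever `h x` is nondegenerate. -/
def christoffel (h : V → V →L[ℝ] V →L[ℝ] ℝ) (x : V) : V →L[ℝ] V →L[ℝ] V :=
  ContinuousLinearMap.compL ℝ V (V →L[ℝ] ℝ) V (ContinuousLinearMap.inverse (h x))
    ∘L christoffelFirst h x

theorem christoffel_apply (h : V → V →L[ℝ] V →L[ℝ] ℝ) (x u v : V) :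
    christoffel h x u v = ContinuousLinearMap.inverse (h x) (christoffelFirst h x u v) := rfl

/-- The curvature tensor `R(u, v) w = ∇_u ∇_v w - ∇_v ∇_u w` of the Levi-Civita connection of `h`,
for the coordinate (constant) fields `u, v, w`. -/
def curvature (h : V → V →L[ℝ] V →L[ℝ] ℝ) (x u v w : V) : V :=
  fderiv ℝ (fun z => christoffel h z v w) x u - fderiv ℝ (fun z => christoffel h z u w) x v
    + christoffel h x u (christoffel h x v w) - christoffel h x v (christoffel h x u w)

/-- The covariant derivative `(∇_u J) v = ∇_u (J v) - J (∇_u v)` of a field `J` of endomorphisms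
with respect to the Levi-Civita connection of `h`. -/
def covDerivEnd (h : V → V →L[ℝ] V →L[ℝ] ℝ) (J : V → V →L[ℝ] V) (x u v : V) : V :=
  fderiv ℝ J x u v + christoffel h x u (J x v) - J x (christoffel h x u v)

/-- The Nijenhuis tensor `N_J(X, Y) = [JX, JY] - J[JX, Y] - J[X, JY] - [X, Y]`, evaluated on the
coordinate (constant) fields `X = u`, `Y = v`, for which `[X, Y] = 0`. -/
def nijenhuis (J : V → V →L[ℝ] V) (x u v : V) : V :=
  VectorField.lieBracket ℝ (fun z => J z u) (fun z => J z v) x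
    - J x (VectorField.lieBracket ℝ (fun z => J z u) (fun _ => v) x)
    - J x (VectorField.lieBracket ℝ (fun _ => u) (fun z => J z v) x)

end LocalGeometry

/-! ## Natural diagonal lifts in an induced chart of the tangent bundle

`γ` is the coordinate expression of the metric of the base manifold in a chart with values in `E`.
A point of the induced chart of the tangent bundle is `z = (x, y) : E × E`, where `x` is the
coordinate of the base point and `y` consists of the components of the tangent vector. -/

/-- The coefficients of a natural diagonal pair `(G, J)`, functions of the energy density `t`. -/
structure DiagonalCoeffs where
  a₁ : ℝ → ℝ
  a₂ : ℝ → ℝ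
  b₁ : ℝ → ℝ
  b₂ : ℝ → ℝ
  c₁ : ℝ → ℝ
  c₂ : ℝ → ℝ
  d₁ : ℝ → ℝ
  d₂ : ℝ → ℝ

section Lifts

variable {E : Type*} [NormedAddCommGroup E] [NormedSpace ℝ E]

/-- The energy density `t = g(y, y) / 2`. -/
def energy (γ : E → E →L[ℝ] E →L[ℝ] ℝ) (z : E × E) : ℝ := γ z.1 z.2 z.2 / 2

/-- The horizontal lift `X ↦ X^H = (X, -Γ(X, y))`; it maps `∂/∂x^i` to
`δ/δx^i = ∂/∂x^i - y^k Γ^h_{ki} ∂/∂y^h`. -/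
def horLift (γ : E → E →L[ℝ] E →L[ℝ] ℝ) (z : E × E) : E →L[ℝ] E × E :=
  (ContinuousLinearMap.id ℝ E).prod (-(christoffel γ z.1).flip z.2)

/-- The vertical lift `X ↦ X^V = (0, X)`. -/
def vertLift : E →L[ℝ] E × E := ContinuousLinearMap.inr ℝ E E

/-- The vertical part of a tangent vector of the tangent bundle:
`w = (horPart w)^H + (vertPart w)^V`. -/
def vertPart (γ : E → E →L[ℝ] E →L[ℝ] ℝ) (z : E × E) : E × E →L[ℝ] E :=
  ContinuousLinearMap.snd ℝ E E + (christoffel γ z.1).flip z.2 ∘L ContinuousLinearMap.fst ℝ E E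

/-- The horizontal part of a tangent vector of the tangent bundle. -/
def horPart : E × E →L[ℝ] E := ContinuousLinearMap.fst ℝ E E

/-- The endomorphism `X ↦ α X + β g(X, y) y`. -/
def natEnd (γ : E → E →L[ℝ] E →L[ℝ] ℝ) (z : E × E) (α β : ℝ) : E →L[ℝ] E :=
  α • ContinuousLinearMap.id ℝ E + β • ((γ z.1).flip z.2).smulRight z.2

/-- The bilinear form `(X, Y) ↦ α g(X, Y) + β g(X, y) g(Y, y)`. -/
def natForm (γ : E → E →L[ℝ] E →L[ℝ] ℝ) (z : E × E) (α β : ℝ) : E →L[ℝ] E →L[ℝ] ℝ :=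
  α • γ z.1 + β • ((γ z.1).flip z.2).smulRight ((γ z.1).flip z.2)

/-- The natural diagonal tensor field `J` of type (1,1); see `liftJ_horLift`, `liftJ_vertLift`. -/
def liftJ (γ : E → E →L[ℝ] E →L[ℝ] ℝ) (κ : DiagonalCoeffs) (z : E × E) : E × E →L[ℝ] E × E :=
  vertLift ∘L natEnd γ z (κ.a₁ (energy γ z)) (κ.b₁ (energy γ z)) ∘L horPart
    - horLift γ z ∘L natEnd γ z (κ.a₂ (energy γ z)) (κ.b₂ (energy γ z)) ∘L vertPart γ z

/-- The natural diagonal metric `G`; see `liftG_horLift_horLift`, `liftG_vertLift_vertLift`,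
`liftG_vertLift_horLift`. -/
def liftG (γ : E → E →L[ℝ] E →L[ℝ] ℝ) (κ : DiagonalCoeffs) (z : E × E) :
    E × E →L[ℝ] E × E →L[ℝ] ℝ :=
  (natForm γ z (κ.c₁ (energy γ z)) (κ.d₁ (energy γ z))).bilinearComp horPart horPart
    + (natForm γ z (κ.c₂ (energy γ z)) (κ.d₂ (energy γ z))).bilinearComp
        (vertPart γ z) (vertPart γ z)

variable (γ : E → E →L[ℝ] E →L[ℝ] ℝ) (κ : DiagonalCoeffs) (z : E × E) (X Y : E)

/-- `J X^H = a₁(t) X^V + b₁(t) g(X, y) y^V`. -/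
theorem liftJ_horLift :
    liftJ γ κ z (horLift γ z X) = κ.a₁ (energy γ z) • vertLift X
      + (κ.b₁ (energy γ z) * γ z.1 X z.2) • vertLift z.2 := by
  ext <;> simp [liftJ, horLift, vertLift, natEnd, horPart, vertPart, mul_smul] <;> abel

/-- `J X^V = -a₂(t) X^H - b₂(t) g(X, y) y^H`. -/
theorem liftJ_vertLift :
    liftJ γ κ z (vertLift X) = -(κ.a₂ (energy γ z) • horLift γ z X)
      - (κ.b₂ (energy γ z) * γ z.1 X z.2) • horLift γ z z.2 := by
  ext <;> simp [liftJ, horLift, vertLift, natEnd, horPart, vertPart, mul_smul] <;> abel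

theorem liftG_horLift_horLift :
    liftG γ κ z (horLift γ z X) (horLift γ z Y) = κ.c₁ (energy γ z) * γ z.1 X Y
      + κ.d₁ (energy γ z) * (γ z.1 X z.2 * γ z.1 Y z.2) := by
  simp [liftG, horLift, natForm, horPart, vertPart]

theorem liftG_vertLift_vertLift :
    liftG γ κ z (vertLift X) (vertLift Y) = κ.c₂ (energy γ z) * γ z.1 X Y
      + κ.d₂ (energy γ z) * (γ z.1 X z.2 * γ z.1 Y z.2) := by
  simp [liftG, vertLift, natForm, horPart, vertPart]

theorem liftG_vertLift_horLift :
    liftG γ κ z (vertLift X) (horLift γ z Y) = 0 := by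
  simp [liftG, vertLift, horLift, natForm, horPart, vertPart]

end Lifts

/-! ## Riemannian manifolds and their tangent bundles -/

section Manifolds

variable {n : ℕ} {M : Type*} [TopologicalSpace M] [ChartedSpace (EuclideanSpace ℝ (Fin n)) M]
  [IsManifold (𝓡 n) ∞ M]

/-- The coordinate expression, in the local chart `e` of `M`, of the Riemannian metric `g`. -/
def chartMetric
    (g : Bundle.ContMDiffRiemannianMetric (𝓡 n) ∞ (EuclideanSpace ℝ (Fin n))
      (TangentSpace (𝓡 n) : M → Type))
    (e : OpenPartialHomeomorph M (EuclideanSpace ℝ (Fin n))) (x : EuclideanSpace ℝ (Fin n)) :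
    EuclideanSpace ℝ (Fin n) →L[ℝ] EuclideanSpace ℝ (Fin n) →L[ℝ] ℝ :=
  ContinuousLinearMap.bilinearComp
    (E := EuclideanSpace ℝ (Fin n)) (F := EuclideanSpace ℝ (Fin n))
    (g.inner (e.symm x)) (mfderiv (𝓡 n) (𝓡 n) e.symm x) (mfderiv (𝓡 n) (𝓡 n) e.symm x)

variable
  (g : Bundle.ContMDiffRiemannianMetric (𝓡 n) ∞ (EuclideanSpace ℝ (Fin n))
    (TangentSpace (𝓡 n) : M → Type))

/-- `(M, g)` has constant sectional curvature `c`: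
`R(X, Y) Z = c (g(Y, Z) X - g(X, Z) Y)` in every local chart. -/
def HasConstantCurvature (c : ℝ) : Prop :=
  ∀ e ∈ IsManifold.maximalAtlas (𝓡 n) ∞ M, ∀ x ∈ e.target, ∀ u v w,
    curvature (chartMetric g e) x u v w =
      c • (chartMetric g e x v w • u - chartMetric g e x u w • v)

/-- The interval `[0, T)` of values of the energy density. -/
def energyRange (T : EReal) : Set ℝ := {t | 0 ≤ t ∧ (t : EReal) < T}

/-- The part of the tube `{t < T}` around the zero section of `TM` that lies over the domain of the
chart `e`, seen in the chart of `TM` induced by `e`. It is the whole of the induced chart domain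
for `T = ⊤`. -/
def chartTube (e : OpenPartialHomeomorph M (EuclideanSpace ℝ (Fin n))) (T : EReal) :
    Set (EuclideanSpace ℝ (Fin n) × EuclideanSpace ℝ (Fin n)) :=
  {z | z.1 ∈ e.target ∧ (energy (chartMetric g e) z : EReal) < T}

/-- The coefficients `κ` are smooth functions on `[0, T)` and define on the tube `{t < T}` in `TM`
an almost complex structure `J` and a nondegenerate metric `G` with `G(JX, JY) = -G(X, Y)`. -/
structure IsAntiHermitian (T : EReal) (κ : DiagonalCoeffs) : Prop where
  smooth_a₁ : ContDiffOn ℝ ∞ κ.a₁ (energyRange T)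
  smooth_a₂ : ContDiffOn ℝ ∞ κ.a₂ (energyRange T)
  smooth_b₁ : ContDiffOn ℝ ∞ κ.b₁ (energyRange T)
  smooth_b₂ : ContDiffOn ℝ ∞ κ.b₂ (energyRange T)
  smooth_c₁ : ContDiffOn ℝ ∞ κ.c₁ (energyRange T)
  smooth_c₂ : ContDiffOn ℝ ∞ κ.c₂ (energyRange T)
  smooth_d₁ : ContDiffOn ℝ ∞ κ.d₁ (energyRange T)
  smooth_d₂ : ContDiffOn ℝ ∞ κ.d₂ (energyRange T)
  almostComplex : ∀ e ∈ IsManifold.maximalAtlas (𝓡 n) ∞ M, ∀ z ∈ chartTube g e T, ∀ w,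
    liftJ (chartMetric g e) κ z (liftJ (chartMetric g e) κ z w) = -w
  nondegenerate : ∀ e ∈ IsManifold.maximalAtlas (𝓡 n) ∞ M, ∀ z ∈ chartTube g e T, ∀ w,
    (∀ w', liftG (chartMetric g e) κ z w w' = 0) → w = 0
  antiHermitian : ∀ e ∈ IsManifold.maximalAtlas (𝓡 n) ∞ M, ∀ z ∈ chartTube g e T, ∀ w w',
    liftG (chartMetric g e) κ z (liftJ (chartMetric g e) κ z w) (liftJ (chartMetric g e) κ z w') =
      -liftG (chartMetric g e) κ z w w'

/-- `(G, J)` is anti-Kähler on the tube `{t < T}`: `∇J = 0` for the Levi-Civita connection `∇`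
of `G`. -/
def IsAntiKahler (T : EReal) (κ : DiagonalCoeffs) : Prop :=
  ∀ e ∈ IsManifold.maximalAtlas (𝓡 n) ∞ M, ∀ z ∈ chartTube g e T, ∀ u v,
    covDerivEnd (liftG (chartMetric g e) κ) (liftJ (chartMetric g e) κ) z u v = 0

/-- `J` is integrable on the tube `{t < T}`: its Nijenhuis tensor vanishes. -/
def IsIntegrable (T : EReal) (κ : DiagonalCoeffs) : Prop :=
  ∀ e ∈ IsManifold.maximalAtlas (𝓡 n) ∞ M, ∀ z ∈ chartTube g e T, ∀ u v,
    nijenhuis (liftJ (chartMetric g e) κ) z u v = 0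

end Manifolds

/-- `b₁ = (a₁ a₁' - c) / (a₁ - 2 t a₁')` on `[0, T)`, with nonvanishing denominator. -/
def IntegrabilityFormula (T : EReal) (κ : DiagonalCoeffs) (c : ℝ) : Prop :=
  ∀ t ∈ energyRange T,
    κ.a₁ t - 2 * t * derivWithin κ.a₁ (energyRange T) t ≠ 0 ∧
    κ.b₁ t = (κ.a₁ t * derivWithin κ.a₁ (energyRange T) t - c) /
      (κ.a₁ t - 2 * t * derivWithin κ.a₁ (energyRange T) t)

/-- `a₁² ≠ 2ct`, `c₁' = 2 c c₁ (a₁ - 2 a₁' t) / (a₁ (a₁² - 2ct))` and `d₁ = c c₂ = -c c₁ / a₁²`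
on `[0, T)`. -/
def MetricFormulas (T : EReal) (κ : DiagonalCoeffs) (c : ℝ) : Prop :=
  ∀ t ∈ energyRange T,
    κ.a₁ t ^ 2 ≠ 2 * c * t ∧
    derivWithin κ.c₁ (energyRange T) t =
      2 * c * κ.c₁ t * (κ.a₁ t - 2 * derivWithin κ.a₁ (energyRange T) t * t) /
        (κ.a₁ t * (κ.a₁ t ^ 2 - 2 * c * t)) ∧
    κ.d₁ t = c * κ.c₂ t ∧
    κ.d₁ t = -c * κ.c₁ t / κ.a₁ t ^ 2

/-- `a₁ = √(B + 2ct)`, `b₁ = 0`, `c₁ = A (B + 2ct)` and `d₁ = -cA` on `[0, T)`. -/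
def SpecialCoeffs (T : EReal) (κ : DiagonalCoeffs) (c A B : ℝ) : Prop :=
  ∀ t ∈ energyRange T,
    κ.a₁ t = Real.sqrt (B + 2 * c * t) ∧
    κ.b₁ t = 0 ∧
    κ.c₁ t = A * (B + 2 * c * t) ∧
    κ.d₁ t = -c * A

end AntiKahler

end

noncomputable section

namespace AntiKahler

/-! ### Levi-Civita connection and curvature of a metric on an open set -/

section Nondegenerate

variable {V : Type*} [NormedAddCommGroup V] [NormedSpace ℝ V] [FiniteDimensional ℝ V]

/-! Write `J X^H = (A X)^V`, where `A` acts on the fibre with eigenvalue `a₁` on the complement of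
`y` and `a₁ + 2 t b₁` along `y`. Everything is computed in induced charts. Metric compatibility of
the Levi-Civita connection of `γ` turns coordinate derivatives into Christoffel terms plus vertical
derivatives of the coefficients, and the Christoffel terms finally cancel or combine into the
curvature `R(X, Y) y`.

Integrability. The Nijenhuis tensor satisfies `N(Ju, v) = -J N(u, v)`, so horizontal arguments
suffice, and it vanishes iff `R(X, Y) y = f(t) (g(Y, y) X - g(X, y) Y)` with `f = a₁ a₁' - b₁ (a₁ -
2 t a₁')` (`nijenhuis_eq_zero_iff_curvature`). The left side is linear in `y`; rescaling `y`
therefore forces `f` to be a constant `c`, which depends on the coefficients only and so is the same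
over all of `M`. This is constant curvature `c`. To solve `f = c` for `b₁` the denominator `a₁ - 2 t
a₁'` must not vanish: its product with `a₁ + 2 t b₁` is `a₁² - 2 c t`, a solution of a homogeneous
linear equation that is nonzero at `0` (`sq_sub_ne_zero_of_curvatureFun_eq`).

The anti-Kähler condition. `∇J = 0` implies `N = 0` because `∇` is torsion-free, so the base is a
space form. Since `∇J` anticommutes with `J`, only its values on horizontal vectors matter; by the
Koszul formula two of their component families vanish identically and two remain
(`covDerivEnd_eq_zero_iff`). On a space form, testing on `y` and a vector orthogonal to it gives `d₁
= c c₂` and a first-order equation for `c₁`; conversely these two, with `f = c` and the algebraic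
compatibility of `G` and `J`, make every component vanish.

The second family is the subfamily with `b₁ = 0`, hence `a₁ a₁' = c` and `a₁² = B + 2 c t`. It
exists exactly as long as `B + 2 c t` stays positive, since `a₁` may not vanish. -/

theorem isInvertible_of_nondegenerate (b : V →L[ℝ] V →L[ℝ] ℝ)
    (hb : ∀ v, (∀ w, b v w = 0) → v = 0) : b.IsInvertible := by
  have hinj : Function.Injective (b : V →ₗ[ℝ] V →L[ℝ] ℝ) := by
    rw [← LinearMap.ker_eq_bot, LinearMap.ker_eq_bot']
    intro v hv
    refine hb v fun w => ?_
    have hv' : b v = 0 := hv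
    simp [hv']
  have hdim : Module.finrank ℝ V = Module.finrank ℝ (V →L[ℝ] ℝ) := by
    rw [← (LinearMap.toContinuousLinearMap (𝕜 := ℝ) (E := V) (F' := ℝ)).finrank_eq]
    exact (Subspace.dual_finrank_eq (K := ℝ) (V := V)).symm
  refine ⟨(LinearEquiv.ofInjectiveOfFinrankEq (b : V →ₗ[ℝ] V →L[ℝ] ℝ) hinj
    hdim).toContinuousLinearEquiv, ?_⟩
  rfl

variable {h : V → V →L[ℝ] V →L[ℝ] ℝ} {x : V}

/-- `ContinuousLinearMap.inverse` is zero on non-invertible maps; nondegeneracy makes it the true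
inverse here. -/
theorem apply_christoffel (hx : ∀ v, (∀ w, h x v w = 0) → v = 0) (u v w : V) :
    h x (christoffel h x u v) w = christoffelFirst h x u v w := by
  have hinv := isInvertible_of_nondegenerate (h x) hx
  rw [christoffel_apply]
  have := congrArg (fun φ => φ (christoffelFirst h x u v)) hinv.self_comp_inverse
  simp only [ContinuousLinearMap.comp_apply, ContinuousLinearMap.id_apply] at this
  rw [this]

end Nondegenerate

section Leibniz

variable {D V W : Type*} [NormedAddCommGroup D] [NormedSpace ℝ D] [NormedAddCommGroup V]
  [NormedSpace ℝ V] [NormedAddCommGroup W] [NormedSpace ℝ W]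

theorem _root_.DifferentiableAt.hasDerivAt_line {f : D → W} {z : D} (hf : DifferentiableAt ℝ f z)
    (p : D) : HasDerivAt (fun s : ℝ => f (z + s • p)) (fderiv ℝ f z p) 0 :=
  hf.hasFDerivAt.hasLineDerivAt p

theorem fderiv_clm_apply_const {f : D → V →L[ℝ] W} {z : D} (hf : DifferentiableAt ℝ f z) (p : D)
    (v : V) : fderiv ℝ (fun z => f z v) z p = fderiv ℝ f z p v := by
  have := (hf.hasFDerivAt.clm_apply (hasFDerivAt_const v z)).fderiv
  simp [this]

theorem fderiv_symm_of_eventually {h : V → V →L[ℝ] V →L[ℝ] ℝ} {x : V}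
    (hd : DifferentiableAt ℝ h x) (hs : ∀ᶠ y in nhds x, ∀ v w, h y v w = h y w v) (u v w : V) :
    fderiv ℝ h x u v w = fderiv ℝ h x u w v := by
  have key : ∀ v w, HasDerivAt (fun s : ℝ => h (x + s • u) v w) (fderiv ℝ h x u v w) 0 := by
    intro v w
    simpa using ((hd.hasDerivAt_line u).clm_apply (hasDerivAt_const _ v)).clm_apply
      (hasDerivAt_const _ w)
  refine (key v w).unique ((key w v).congr_of_eventuallyEq ?_)
  have hc : Filter.Tendsto (fun s : ℝ => x + s • u) (nhds 0) (nhds x) := by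
    have : Continuous fun s : ℝ => x + s • u := by fun_prop
    simpa using this.tendsto 0
  filter_upwards [hc hs] with s hs using hs v w

theorem christoffel_symm_of_eventually {h : V → V →L[ℝ] V →L[ℝ] ℝ} {x : V}
    (hd : DifferentiableAt ℝ h x) (hs : ∀ᶠ y in nhds x, ∀ v w, h y v w = h y w v) (u v : V) :
    christoffel h x u v = christoffel h x v u := by
  rw [christoffel_apply, christoffel_apply]
  congr 1
  refine ContinuousLinearMap.ext fun w => ?_
  rw [christoffelFirst_apply, christoffelFirst_apply, fderiv_symm_of_eventually hd hs w u v]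
  ring

end Leibniz

/-- `γ` is the coordinate expression of a smooth Riemannian metric on the open set `U`. -/
structure IsMetricOn {E : Type*} [NormedAddCommGroup E] [NormedSpace ℝ E]
    (γ : E → E →L[ℝ] E →L[ℝ] ℝ) (U : Set E) : Prop where
  isOpen : IsOpen U
  smooth : ContDiffOn ℝ ∞ γ U
  symm : ∀ x ∈ U, ∀ u v, γ x u v = γ x v u
  pos : ∀ x ∈ U, ∀ v, v ≠ 0 → 0 < γ x v v

section Metric

variable {E : Type*} [NormedAddCommGroup E] [NormedSpace ℝ E]
  {γ : E → E →L[ℝ] E →L[ℝ] ℝ} {U : Set E} {x : E}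

namespace IsMetricOn

theorem contDiffAt (hγ : IsMetricOn γ U) (hx : x ∈ U) : ContDiffAt ℝ ∞ γ x :=
  hγ.smooth.contDiffAt (hγ.isOpen.mem_nhds hx)

theorem differentiableAt (hγ : IsMetricOn γ U) (hx : x ∈ U) : DifferentiableAt ℝ γ x :=
  (hγ.contDiffAt hx).differentiableAt (by simp)

theorem nondegenerate (hγ : IsMetricOn γ U) (hx : x ∈ U) (v : E) (hv : ∀ w, γ x v w = 0) :
    v = 0 := by
  by_contra hne
  exact (hγ.pos x hx v hne).ne' (hv v)

theorem nonneg (hγ : IsMetricOn γ U) (hx : x ∈ U) (v : E) : 0 ≤ γ x v v := by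
  by_cases hv : v = 0
  · simp [hv]
  · exact (hγ.pos x hx v hv).le

theorem fderiv_symm (hγ : IsMetricOn γ U) (hx : x ∈ U) (u v w : E) :
    fderiv ℝ γ x u v w = fderiv ℝ γ x u w v :=
  fderiv_symm_of_eventually (hγ.differentiableAt hx) (by
    filter_upwards [hγ.isOpen.mem_nhds hx] with y hy using hγ.symm y hy) u v w

theorem christoffel_symm (hγ : IsMetricOn γ U) (hx : x ∈ U) (u v : E) :
    christoffel γ x u v = christoffel γ x v u :=
  christoffel_symm_of_eventually (hγ.differentiableAt hx) (by
    filter_upwards [hγ.isOpen.mem_nhds hx] with y hy using hγ.symm y hy) u v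

variable [FiniteDimensional ℝ E]

/-- Metric compatibility `∇γ = 0`: in the sum of the two first-kind symbols the other derivatives
cancel. It is what makes the later derivatives tensorial. -/
theorem fderiv_eq (hγ : IsMetricOn γ U) (hx : x ∈ U) (u v w : E) :
    fderiv ℝ γ x u v w = γ x (christoffel γ x u v) w + γ x v (christoffel γ x u w) := by
  rw [hγ.symm x hx v, apply_christoffel (hγ.nondegenerate hx),
    apply_christoffel (hγ.nondegenerate hx), christoffelFirst_apply, christoffelFirst_apply,
    hγ.fderiv_symm hx u w v, hγ.fderiv_symm hx w u v]
  ring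

theorem contDiffAt_christoffel (hγ : IsMetricOn γ U) (hx : x ∈ U) :
    ContDiffAt ℝ ∞ (christoffel γ) x := by
  have h1 : ContDiffAt ℝ ∞ (fun x => ContinuousLinearMap.inverse (γ x)) x :=
    (isInvertible_of_nondegenerate (γ x)
      (hγ.nondegenerate hx)).contDiffAt_map_inverse.comp x (hγ.contDiffAt hx)
  have h2 : ContDiffAt ℝ ∞ (fderiv ℝ γ) x := (hγ.contDiffAt hx).fderiv_right (by simp)
  have h2f : ContDiffAt ℝ ∞ (fun x => (fderiv ℝ γ x).flip) x :=
    (ContinuousLinearMap.flipₗᵢ ℝ E E (E →L[ℝ] ℝ)).toContinuousLinearEquiv.contDiff.contDiffAt.comp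
      x h2
  have h3 : ContDiffAt ℝ ∞ (christoffelFirst γ) x := by
    unfold christoffelFirst
    exact ((h2.add h2f).sub (contDiffAt_const.clm_comp h2f)).const_smul (1 / 2 : ℝ)
  unfold christoffel
  exact ((ContinuousLinearMap.contDiff _).contDiffAt.comp x h1).clm_comp h3

theorem differentiableAt_christoffel (hγ : IsMetricOn γ U) (hx : x ∈ U) :
    DifferentiableAt ℝ (christoffel γ) x :=
  (hγ.contDiffAt_christoffel hx).differentiableAt (by simp)

/-- The terms are grouped so that each bracket is a horizontal derivative of the vertical projection
(`horDeriv`) at `y = w`. -/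
theorem curvature_eq (hγ : IsMetricOn γ U) (hx : x ∈ U) (u v w : E) :
    curvature γ x u v w = (fderiv ℝ (christoffel γ) x u v w
        - christoffel γ x v (christoffel γ x u w))
      - (fderiv ℝ (christoffel γ) x v u w - christoffel γ x u (christoffel γ x v w)) := by
  have hd := hγ.differentiableAt_christoffel hx
  have key : ∀ u v w, fderiv ℝ (fun z => christoffel γ z v w) x u
      = fderiv ℝ (christoffel γ) x u v w := by
    intro u v w
    rw [← fderiv_clm_apply_const hd, fderiv_clm_apply_const (f := fun z => christoffel γ z v)]
    · exact hd.clm_apply (differentiableAt_const v)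
  rw [curvature, key, key]
  abel

end IsMetricOn

end Metric

/-! ### Smoothness of the lifted tensors on the tube -/

section Tube

/-- All coefficients are smooth on `s`. -/
def DiagonalCoeffs.SmoothOn (κ : DiagonalCoeffs) (s : Set ℝ) : Prop :=
  (ContDiffOn ℝ ∞ κ.a₁ s ∧ ContDiffOn ℝ ∞ κ.a₂ s) ∧ (ContDiffOn ℝ ∞ κ.b₁ s ∧ ContDiffOn ℝ ∞ κ.b₂ s)
    ∧ (ContDiffOn ℝ ∞ κ.c₁ s ∧ ContDiffOn ℝ ∞ κ.c₂ s)
    ∧ (ContDiffOn ℝ ∞ κ.d₁ s ∧ ContDiffOn ℝ ∞ κ.d₂ s)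

variable {E : Type*} [NormedAddCommGroup E] [NormedSpace ℝ E]

/-- The part of the tube `{t < T}` over `U`. -/
def tube (γ : E → E →L[ℝ] E →L[ℝ] ℝ) (U : Set E) (T : EReal) : Set (E × E) :=
  {z | z.1 ∈ U ∧ (energy γ z : EReal) < T}

variable {γ : E → E →L[ℝ] E →L[ℝ] ℝ} {U : Set E} {T : EReal} {z : E × E} {κ : DiagonalCoeffs}

theorem IsMetricOn.contDiffAt_metric_fst (hγ : IsMetricOn γ U) (hz : z.1 ∈ U) :
    ContDiffAt ℝ ∞ (fun z : E × E => γ z.1) z :=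
  (hγ.contDiffAt hz).comp z contDiffAt_fst

theorem IsMetricOn.contDiffAt_energy (hγ : IsMetricOn γ U) (hz : z.1 ∈ U) :
    ContDiffAt ℝ ∞ (energy γ) z := by
  have h1 := hγ.contDiffAt_metric_fst hz
  exact ((h1.clm_apply contDiffAt_snd).clm_apply contDiffAt_snd).div_const 2

theorem IsMetricOn.energy_mem (hγ : IsMetricOn γ U) (hz : z ∈ tube γ U T) :
    energy γ z ∈ energyRange T :=
  ⟨div_nonneg (hγ.nonneg hz.1 _) (by norm_num), hz.2⟩

theorem IsMetricOn.isOpen_tube (hγ : IsMetricOn γ U) : IsOpen (tube γ U T) := by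
  rw [isOpen_iff_mem_nhds]
  intro z hz
  have h1 : ∀ᶠ w in nhds z, w.1 ∈ U := continuous_fst.continuousAt (hγ.isOpen.mem_nhds hz.1)
  have h2 : ContinuousAt (fun w => (energy γ w : EReal)) z :=
    continuous_coe_real_ereal.continuousAt.comp (hγ.contDiffAt_energy hz.1).continuousAt
  filter_upwards [h1, h2 (Iio_mem_nhds hz.2)] with w hw1 hw2
  exact ⟨hw1, hw2⟩

/-- Although `f` is smooth only on the half-open interval, the energy maps the open tube into it, so
the composite is smooth even across the zero section. -/
theorem IsMetricOn.contDiffAt_comp_energy (hγ : IsMetricOn γ U) (hz : z ∈ tube γ U T) {f : ℝ → ℝ}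
    (hf : ContDiffOn ℝ ∞ f (energyRange T)) : ContDiffAt ℝ ∞ (fun z => f (energy γ z)) z := by
  have h1 : ContDiffOn ℝ ∞ (energy γ) (tube γ U T) :=
    fun w hw => (hγ.contDiffAt_energy hw.1).contDiffWithinAt
  exact (hf.comp h1 fun w hw => hγ.energy_mem hw).contDiffAt (hγ.isOpen_tube.mem_nhds hz)

theorem vertPart_apply (p : E × E) :
    vertPart γ z p = p.2 + christoffel γ z.1 p.1 z.2 := by simp [vertPart]

theorem natEnd_apply (α β : ℝ) (X : E) :
    natEnd γ z α β X = α • X + (β * γ z.1 X z.2) • z.2 := by simp [natEnd, mul_smul]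

theorem natForm_apply (α β : ℝ) (X Y : E) :
    natForm γ z α β X Y = α * γ z.1 X Y + β * (γ z.1 X z.2 * γ z.1 Y z.2) := by simp [natForm]

theorem liftJ_apply (v : E × E) :
    liftJ γ κ z v = (-natEnd γ z (κ.a₂ (energy γ z)) (κ.b₂ (energy γ z)) (vertPart γ z v),
      natEnd γ z (κ.a₁ (energy γ z)) (κ.b₁ (energy γ z)) v.1 + christoffel γ z.1
        (natEnd γ z (κ.a₂ (energy γ z)) (κ.b₂ (energy γ z)) (vertPart γ z v)) z.2) := by
  ext <;> simp [liftJ, horLift, vertLift, horPart]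

theorem liftJ_fst (v : E × E) : (liftJ γ κ z v).1 =
    -natEnd γ z (κ.a₂ (energy γ z)) (κ.b₂ (energy γ z)) (vertPart γ z v) := by
  rw [liftJ_apply]

theorem vertPart_liftJ (v : E × E) : vertPart γ z (liftJ γ κ z v) =
    natEnd γ z (κ.a₁ (energy γ z)) (κ.b₁ (energy γ z)) v.1 := by
  rw [liftJ_apply, vertPart_apply]
  simp

theorem liftG_apply (v w : E × E) :
    liftG γ κ z v w = natForm γ z (κ.c₁ (energy γ z)) (κ.d₁ (energy γ z)) v.1 w.1
      + natForm γ z (κ.c₂ (energy γ z)) (κ.d₂ (energy γ z)) (vertPart γ z v) (vertPart γ z w) := by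
  simp [liftG, horPart]

theorem IsMetricOn.contDiffAt_natEnd (hγ : IsMetricOn γ U) (hz : z.1 ∈ U) {a b : E × E → ℝ}
    {X : E × E → E} (ha : ContDiffAt ℝ ∞ a z) (hb : ContDiffAt ℝ ∞ b z)
    (hX : ContDiffAt ℝ ∞ X z) : ContDiffAt ℝ ∞ (fun z => natEnd γ z (a z) (b z) (X z)) z := by
  simp only [natEnd_apply]
  exact (ha.smul hX).add ((hb.mul (((hγ.contDiffAt_metric_fst hz).clm_apply hX).clm_apply
    contDiffAt_snd)).smul contDiffAt_snd)

theorem IsMetricOn.contDiffAt_natForm (hγ : IsMetricOn γ U) (hz : z.1 ∈ U) {a b : E × E → ℝ}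
    {X Y : E × E → E} (ha : ContDiffAt ℝ ∞ a z) (hb : ContDiffAt ℝ ∞ b z)
    (hX : ContDiffAt ℝ ∞ X z) (hY : ContDiffAt ℝ ∞ Y z) :
    ContDiffAt ℝ ∞ (fun z => natForm γ z (a z) (b z) (X z) (Y z)) z := by
  have h1 := hγ.contDiffAt_metric_fst hz
  simp only [natForm_apply]
  exact (ha.mul ((h1.clm_apply hX).clm_apply hY)).add
    (hb.mul (((h1.clm_apply hX).clm_apply contDiffAt_snd).mul
      ((h1.clm_apply hY).clm_apply contDiffAt_snd)))

variable [FiniteDimensional ℝ E]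

theorem IsMetricOn.contDiffAt_christoffel_fst (hγ : IsMetricOn γ U) (hz : z.1 ∈ U) :
    ContDiffAt ℝ ∞ (fun z : E × E => christoffel γ z.1) z :=
  (hγ.contDiffAt_christoffel hz).comp z contDiffAt_fst

theorem IsMetricOn.contDiffAt_vertPart (hγ : IsMetricOn γ U) (hz : z.1 ∈ U) (v : E × E) :
    ContDiffAt ℝ ∞ (fun z => vertPart γ z v) z := by
  simp only [vertPart_apply]
  exact contDiffAt_const.add (((hγ.contDiffAt_christoffel_fst hz).clm_apply
    contDiffAt_const).clm_apply contDiffAt_snd)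

theorem IsMetricOn.contDiffAt_liftJ (hγ : IsMetricOn γ U) (hz : z ∈ tube γ U T)
    (hκ : κ.SmoothOn (energyRange T)) : ContDiffAt ℝ ∞ (liftJ γ κ) z := by
  suffices h : ContDiffOn ℝ ∞ (liftJ γ κ) (tube γ U T) from
    h.contDiffAt (hγ.isOpen_tube.mem_nhds hz)
  rw [contDiffOn_clm_apply]
  intro v w hw
  obtain ⟨⟨ha1, ha2⟩, ⟨hb1, hb2⟩, -⟩ := hκ
  replace ha1 := hγ.contDiffAt_comp_energy hw ha1
  replace ha2 := hγ.contDiffAt_comp_energy hw ha2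
  replace hb1 := hγ.contDiffAt_comp_energy hw hb1
  replace hb2 := hγ.contDiffAt_comp_energy hw hb2
  have h1 := hγ.contDiffAt_natEnd hw.1 ha2 hb2 (hγ.contDiffAt_vertPart hw.1 v)
  apply ContDiffAt.contDiffWithinAt
  simp only [liftJ_apply]
  exact h1.neg.prodMk ((hγ.contDiffAt_natEnd hw.1 ha1 hb1 contDiffAt_const).add
    (((hγ.contDiffAt_christoffel_fst hw.1).clm_apply h1).clm_apply contDiffAt_snd))

theorem IsMetricOn.contDiffAt_liftG (hγ : IsMetricOn γ U) (hz : z ∈ tube γ U T)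
    (hκ : κ.SmoothOn (energyRange T)) : ContDiffAt ℝ ∞ (liftG γ κ) z := by
  suffices h : ContDiffOn ℝ ∞ (liftG γ κ) (tube γ U T) from
    h.contDiffAt (hγ.isOpen_tube.mem_nhds hz)
  rw [contDiffOn_clm_apply]
  intro v
  rw [contDiffOn_clm_apply]
  intro v' w hw
  obtain ⟨-, -, ⟨ha1, ha2⟩, ⟨hb1, hb2⟩⟩ := hκ
  replace ha1 := hγ.contDiffAt_comp_energy hw ha1
  replace ha2 := hγ.contDiffAt_comp_energy hw ha2
  replace hb1 := hγ.contDiffAt_comp_energy hw hb1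
  replace hb2 := hγ.contDiffAt_comp_energy hw hb2
  apply ContDiffAt.contDiffWithinAt
  simp only [liftG_apply]
  exact (hγ.contDiffAt_natForm hw.1 ha1 hb1 contDiffAt_const contDiffAt_const).add
    (hγ.contDiffAt_natForm hw.1 ha2 hb2 (hγ.contDiffAt_vertPart hw.1 v)
      (hγ.contDiffAt_vertPart hw.1 v'))

end Tube

/-! ### Derivatives of natural tensors along lines in the tube -/

section Derivatives

variable {E : Type*} [NormedAddCommGroup E] [NormedSpace ℝ E]

/-- The derivative of `natEnd` with coefficients `α(t)`, `β(t)` in the vertical direction `K`. -/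
def natEndDeriv (γ : E → E →L[ℝ] E →L[ℝ] ℝ) (z : E × E) (α' β β' : ℝ) (K X : E) : E :=
  (α' * γ z.1 K z.2) • X + (β' * γ z.1 K z.2 * γ z.1 X z.2) • z.2
    + β • (γ z.1 X K • z.2 + γ z.1 X z.2 • K)

/-- The derivative of `natForm` with coefficients `α(t)`, `β(t)` in the vertical direction `K`. -/
def natFormDeriv (γ : E → E →L[ℝ] E →L[ℝ] ℝ) (z : E × E) (α' β β' : ℝ) (K X Y : E) : ℝ :=
  α' * γ z.1 K z.2 * γ z.1 X Y + β' * γ z.1 K z.2 * (γ z.1 X z.2 * γ z.1 Y z.2)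
    + β * (γ z.1 X K * γ z.1 Y z.2 + γ z.1 X z.2 * γ z.1 Y K)

/-- The derivative of `vertPart` in the direction `p`, applied to a vector with first
component `X`. -/
def vertPartDeriv (γ : E → E →L[ℝ] E →L[ℝ] ℝ) (z p : E × E) (X : E) : E :=
  fderiv ℝ (christoffel γ) z.1 p.1 X z.2 + christoffel γ z.1 X p.2

variable [FiniteDimensional ℝ E] {γ : E → E →L[ℝ] E →L[ℝ] ℝ} {U : Set E} {T : EReal}
  {z : E × E} {κ : DiagonalCoeffs}

namespace IsMetricOn

omit [FiniteDimensional ℝ E] in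
theorem hasDerivAt_metric (hγ : IsMetricOn γ U) (hz : z.1 ∈ U) (p : E × E) :
    HasDerivAt (fun s : ℝ => γ (z + s • p).1) (fderiv ℝ γ z.1 p.1) 0 := by
  simpa using (hγ.differentiableAt hz).hasDerivAt_line p.1

theorem hasDerivAt_christoffel (hγ : IsMetricOn γ U) (hz : z.1 ∈ U) (p : E × E) :
    HasDerivAt (fun s : ℝ => christoffel γ (z + s • p).1)
      (fderiv ℝ (christoffel γ) z.1 p.1) 0 := by
  simpa using (hγ.differentiableAt_christoffel hz).hasDerivAt_line p.1

omit [FiniteDimensional ℝ E] in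
theorem _root_.AntiKahler.hasDerivAt_line_snd (z p : E × E) :
    HasDerivAt (fun s : ℝ => (z + s • p).2) p.2 0 := by
  simpa using ((hasDerivAt_id (0 : ℝ)).smul_const p.2).const_add z.2

omit [FiniteDimensional ℝ E] in
theorem _root_.AntiKahler.hasDerivAt_fst {v : ℝ → E × E} {v' : E × E} (hv : HasDerivAt v v' 0) :
    HasDerivAt (fun s => (v s).1) v'.1 0 :=
  (ContinuousLinearMap.fst ℝ E E).hasFDerivAt.comp_hasDerivAt 0 hv

omit [FiniteDimensional ℝ E] in
theorem _root_.AntiKahler.hasDerivAt_snd {v : ℝ → E × E} {v' : E × E} (hv : HasDerivAt v v' 0) :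
    HasDerivAt (fun s => (v s).2) v'.2 0 :=
  (ContinuousLinearMap.snd ℝ E E).hasFDerivAt.comp_hasDerivAt 0 hv

theorem hasDerivAt_vertPart (hγ : IsMetricOn γ U) (hz : z.1 ∈ U) (p : E × E) {v : ℝ → E × E}
    {v' : E × E} (hv : HasDerivAt v v' 0) :
    HasDerivAt (fun s : ℝ => vertPart γ (z + s • p) (v s))
      (vertPartDeriv γ z p (v 0).1 + vertPart γ z v') 0 := by
  simp only [vertPart_apply]
  have := (hasDerivAt_snd hv).add
    (((hγ.hasDerivAt_christoffel hz p).clm_apply (hasDerivAt_fst hv)).clm_apply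
    (hasDerivAt_line_snd z p))
  convert! this using 1
  simp only [vertPartDeriv, zero_smul, add_zero, add_apply]
  abel

/-- By metric compatibility only the vertical part of `p` contributes: the energy is stationary in
horizontal directions. -/
theorem hasDerivAt_energy (hγ : IsMetricOn γ U) (hz : z.1 ∈ U) (p : E × E) :
    HasDerivAt (fun s : ℝ => energy γ (z + s • p)) (γ z.1 (vertPart γ z p) z.2) 0 := by
  have h2 := hasDerivAt_line_snd z p
  have := (((hγ.hasDerivAt_metric hz p).clm_apply h2).clm_apply h2).div_const 2
  convert! this using 1
  simp only [vertPart_apply, zero_smul, add_zero, add_apply, map_add,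
    hγ.fderiv_eq hz, hγ.symm _ hz z.2]
  ring

/-- A chain rule with a one-sided outer derivative; it yields a two-sided derivative because the
energy of points of the tube never leaves `[0, T)`. -/
theorem hasDerivAt_comp_energy (hγ : IsMetricOn γ U) (hz : z ∈ tube γ U T) {f : ℝ → ℝ}
    (hf : ContDiffOn ℝ ∞ f (energyRange T)) (p : E × E) :
    HasDerivAt (fun s : ℝ => f (energy γ (z + s • p)))
      (derivWithin f (energyRange T) (energy γ z) * γ z.1 (vertPart γ z p) z.2) 0 := by
  have hf' : HasDerivWithinAt f (derivWithin f (energyRange T) (energy γ z)) (energyRange T)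
      (energy γ (z + (0 : ℝ) • p)) := by
    simpa using ((hf.differentiableOn (by simp)) _ (hγ.energy_mem hz)).hasDerivWithinAt
  have hc : Filter.Tendsto (fun s : ℝ => z + s • p) (nhds 0) (nhds z) := by
    have : Continuous fun s : ℝ => z + s • p := by fun_prop
    simpa using this.tendsto 0
  refine hf'.comp_hasDerivAt 0 (hγ.hasDerivAt_energy hz.1 p) ?_
  filter_upwards [hc (hγ.isOpen_tube.mem_nhds hz)] with s hs
  exact hγ.energy_mem hs

theorem hasDerivAt_natEnd (hγ : IsMetricOn γ U) (hz : z.1 ∈ U) (p : E × E) {a b : ℝ → ℝ}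
    {a' b' : ℝ} {X : ℝ → E} {X' : E}
    (ha : HasDerivAt a (a' * γ z.1 (vertPart γ z p) z.2) 0)
    (hb : HasDerivAt b (b' * γ z.1 (vertPart γ z p) z.2) 0) (hX : HasDerivAt X X' 0) :
    HasDerivAt (fun s : ℝ => natEnd γ (z + s • p) (a s) (b s) (X s))
      (natEnd γ z (a 0) (b 0) (christoffel γ z.1 p.1 (X 0) + X')
        - christoffel γ z.1 p.1 (natEnd γ z (a 0) (b 0) (X 0))
        + natEndDeriv γ z a' (b 0) b' (vertPart γ z p) (X 0)) 0 := by
  have h2 := hasDerivAt_line_snd z p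
  simp only [natEnd_apply]
  have := (ha.smul hX).add
    ((hb.mul (((hγ.hasDerivAt_metric hz p).clm_apply hX).clm_apply h2)).smul h2)
  convert! this using 1
  simp only [vertPart_apply, natEndDeriv, zero_smul, add_zero, add_apply,
    map_add, map_smul, hγ.fderiv_eq hz,
    Pi.mul_apply]
  module

theorem hasDerivAt_natForm (hγ : IsMetricOn γ U) (hz : z.1 ∈ U) (p : E × E) {a b : ℝ → ℝ}
    {a' b' : ℝ} {X Y : ℝ → E} {X' Y' : E}
    (ha : HasDerivAt a (a' * γ z.1 (vertPart γ z p) z.2) 0)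
    (hb : HasDerivAt b (b' * γ z.1 (vertPart γ z p) z.2) 0) (hX : HasDerivAt X X' 0)
    (hY : HasDerivAt Y Y' 0) :
    HasDerivAt (fun s : ℝ => natForm γ (z + s • p) (a s) (b s) (X s) (Y s))
      (natForm γ z (a 0) (b 0) (christoffel γ z.1 p.1 (X 0) + X') (Y 0)
        + natForm γ z (a 0) (b 0) (X 0) (christoffel γ z.1 p.1 (Y 0) + Y')
        + natFormDeriv γ z a' (b 0) b' (vertPart γ z p) (X 0) (Y 0)) 0 := by
  have h2 := hasDerivAt_line_snd z p
  have h1 := hγ.hasDerivAt_metric hz p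
  simp only [natForm_apply]
  have := (ha.mul ((h1.clm_apply hX).clm_apply hY)).add
    (hb.mul (((h1.clm_apply hX).clm_apply h2).mul ((h1.clm_apply hY).clm_apply h2)))
  convert! this using 1
  simp only [vertPart_apply, natFormDeriv, zero_smul, add_zero, add_apply,
    map_add, hγ.fderiv_eq hz, Pi.mul_apply]
  ring

end IsMetricOn

end Derivatives

/-! ### Nijenhuis tensor and covariant derivative of a general almost complex structure -/

section General

variable {V : Type*} [NormedAddCommGroup V] [NormedSpace ℝ V]
  {h : V → V →L[ℝ] V →L[ℝ] ℝ} {J : V → V →L[ℝ] V} {x : V}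

theorem nijenhuis_eq (hJ : DifferentiableAt ℝ J x) (u v : V) :
    nijenhuis J x u v = fderiv ℝ J x (J x u) v - fderiv ℝ J x (J x v) u
      + J x (fderiv ℝ J x v u) - J x (fderiv ℝ J x u v) := by
  simp only [nijenhuis, VectorField.lieBracket, fderiv_clm_apply_const hJ, fderiv_fun_const,
    Pi.zero_apply, zero_apply, sub_zero, zero_sub, map_neg]
  abel

/-- Differentiate `J² = -1`. -/
theorem fderiv_apply_comp_self (hJ : DifferentiableAt ℝ J x)
    (hJ2 : ∀ᶠ z in nhds x, ∀ v, J z (J z v) = -v) (u v : V) :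
    fderiv ℝ J x u (J x v) = -J x (fderiv ℝ J x u v) := by
  have h1 := hJ.hasDerivAt_line u
  have h2 := h1.clm_apply (h1.clm_apply (hasDerivAt_const (0 : ℝ) v))
  have hc : Filter.Tendsto (fun s : ℝ => x + s • u) (nhds 0) (nhds x) := by
    have : Continuous fun s : ℝ => x + s • u := by fun_prop
    simpa using this.tendsto 0
  have h3 : (fun s : ℝ => J (x + s • u) (J (x + s • u) v)) =ᶠ[nhds 0] fun _ => -v := by
    filter_upwards [hc hJ2] with s hs
    exact hs v
  have h4 := h2.unique ((hasDerivAt_const (0 : ℝ) (-v)).congr_of_eventuallyEq h3)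
  simp only [zero_smul, add_zero, map_zero] at h4
  exact eq_neg_of_add_eq_zero_left h4

theorem nijenhuis_apply_left (hJ : DifferentiableAt ℝ J x)
    (hJ2 : ∀ᶠ z in nhds x, ∀ v, J z (J z v) = -v) (u v : V) :
    nijenhuis J x (J x u) v = -J x (nijenhuis J x u v) := by
  have hx := hJ2.self_of_nhds
  simp only [nijenhuis_eq hJ, hx, map_neg, map_add, map_sub, neg_apply,
    fderiv_apply_comp_self hJ hJ2]
  abel

theorem nijenhuis_antisymm (hJ : DifferentiableAt ℝ J x) (u v : V) :
    nijenhuis J x u v = -nijenhuis J x v u := by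
  simp only [nijenhuis_eq hJ]
  abel

theorem covDerivEnd_apply_comp_self (hJ : DifferentiableAt ℝ J x)
    (hJ2 : ∀ᶠ z in nhds x, ∀ v, J z (J z v) = -v) (u v : V) :
    covDerivEnd h J x u (J x v) = -J x (covDerivEnd h J x u v) := by
  have hx := hJ2.self_of_nhds
  simp only [covDerivEnd, hx, map_neg, map_add, map_sub, fderiv_apply_comp_self hJ hJ2]
  abel

/-- A torsion-free connection preserving `J` forces the Nijenhuis tensor of `J` to vanish. -/
theorem nijenhuis_eq_zero_of_covDerivEnd (hJ : DifferentiableAt ℝ J x)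
    (hJ2 : ∀ v, J x (J x v) = -v) (hsymm : ∀ u v, christoffel h x u v = christoffel h x v u)
    (hcov : ∀ u v, covDerivEnd h J x u v = 0) (u v : V) : nijenhuis J x u v = 0 := by
  have key : ∀ u v, fderiv ℝ J x u v = J x (christoffel h x u v) - christoffel h x u (J x v) := by
    intro u v
    have := hcov u v
    rw [covDerivEnd, sub_eq_zero] at this
    exact eq_sub_of_add_eq this
  simp only [nijenhuis_eq hJ, key, map_sub, hJ2, hsymm v u, hsymm (J x v) u, hsymm (J x u) v,
    hsymm (J x v) (J x u)]
  abel

/-- Purity moves `J` to the second argument, after which both Christoffel terms are given by the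
Koszul formula. The inverse of the metric thus never has to be computed. -/
theorem metric_covDerivEnd [FiniteDimensional ℝ V] (hnd : ∀ v, (∀ w, h x v w = 0) → v = 0)
    (hpure : ∀ v w, h x (J x v) w = h x v (J x w)) (u v w : V) :
    h x (covDerivEnd h J x u v) w = h x (fderiv ℝ J x u v) w
      + (fderiv ℝ h x u (J x v) w + fderiv ℝ h x (J x v) u w - fderiv ℝ h x w u (J x v)) / 2
      - (fderiv ℝ h x u v (J x w) + fderiv ℝ h x v u (J x w) - fderiv ℝ h x (J x w) u v) / 2 := by
  simp only [covDerivEnd, map_add, map_sub, add_apply, sub_apply, hpure, apply_christoffel hnd,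
    christoffelFirst_apply]

end General

/-! ### The lifted structure in the horizontal-vertical splitting -/

section Lift

variable {E : Type*} [NormedAddCommGroup E] [NormedSpace ℝ E]

/-- The operator `A` with `J X^H = (A X)^V`. -/
def opH (γ : E → E →L[ℝ] E →L[ℝ] ℝ) (κ : DiagonalCoeffs) (z : E × E) : E →L[ℝ] E :=
  natEnd γ z (κ.a₁ (energy γ z)) (κ.b₁ (energy γ z))

/-- The operator `B` with `J X^V = -(B X)^H`. -/
def opV (γ : E → E →L[ℝ] E →L[ℝ] ℝ) (κ : DiagonalCoeffs) (z : E × E) : E →L[ℝ] E :=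
  natEnd γ z (κ.a₂ (energy γ z)) (κ.b₂ (energy γ z))

/-- `G` on horizontal lifts. -/
def formH (γ : E → E →L[ℝ] E →L[ℝ] ℝ) (κ : DiagonalCoeffs) (z : E × E) : E →L[ℝ] E →L[ℝ] ℝ :=
  natForm γ z (κ.c₁ (energy γ z)) (κ.d₁ (energy γ z))

/-- `G` on vertical lifts. -/
def formV (γ : E → E →L[ℝ] E →L[ℝ] ℝ) (κ : DiagonalCoeffs) (z : E × E) : E →L[ℝ] E →L[ℝ] ℝ :=
  natForm γ z (κ.c₂ (energy γ z)) (κ.d₂ (energy γ z))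

/-- The derivative of `opH` in the vertical direction `K`. -/
def opHDeriv (γ : E → E →L[ℝ] E →L[ℝ] ℝ) (κ : DiagonalCoeffs) (T : EReal) (z : E × E) (K X : E) :
    E :=
  natEndDeriv γ z (derivWithin κ.a₁ (energyRange T) (energy γ z)) (κ.b₁ (energy γ z))
    (derivWithin κ.b₁ (energyRange T) (energy γ z)) K X

/-- The derivative of `opV` in the vertical direction `K`. -/
def opVDeriv (γ : E → E →L[ℝ] E →L[ℝ] ℝ) (κ : DiagonalCoeffs) (T : EReal) (z : E × E) (K X : E) :
    E :=
  natEndDeriv γ z (derivWithin κ.a₂ (energyRange T) (energy γ z)) (κ.b₂ (energy γ z))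
    (derivWithin κ.b₂ (energyRange T) (energy γ z)) K X

/-- The derivative of `formH` in the vertical direction `K`. -/
def formHDeriv (γ : E → E →L[ℝ] E →L[ℝ] ℝ) (κ : DiagonalCoeffs) (T : EReal) (z : E × E)
    (K X Y : E) : ℝ :=
  natFormDeriv γ z (derivWithin κ.c₁ (energyRange T) (energy γ z)) (κ.d₁ (energy γ z))
    (derivWithin κ.d₁ (energyRange T) (energy γ z)) K X Y

/-- The derivative of `formV` in the vertical direction `K`. -/
def formVDeriv (γ : E → E →L[ℝ] E →L[ℝ] ℝ) (κ : DiagonalCoeffs) (T : EReal) (z : E × E)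
    (K X Y : E) : ℝ :=
  natFormDeriv γ z (derivWithin κ.c₂ (energyRange T) (energy γ z)) (κ.d₂ (energy γ z))
    (derivWithin κ.d₂ (energyRange T) (energy γ z)) K X Y

/-- The derivative of `vertPart` in the direction `P^H`, applied to a vector with first
component `X`. -/
def horDeriv (γ : E → E →L[ℝ] E →L[ℝ] ℝ) (z : E × E) (P X : E) : E :=
  fderiv ℝ (christoffel γ) z.1 P X z.2 - christoffel γ z.1 X (christoffel γ z.1 P z.2)

variable {γ : E → E →L[ℝ] E →L[ℝ] ℝ} {U : Set E} {T : EReal} {z : E × E} {κ : DiagonalCoeffs}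

theorem horLift_fst (X : E) : (horLift γ z X).1 = X := rfl

theorem vertLift_fst (X : E) : (vertLift X : E × E).1 = 0 := rfl

theorem vertPart_horLift (X : E) : vertPart γ z (horLift γ z X) = 0 := by
  simp [vertPart_apply, horLift]

theorem vertPart_vertLift (X : E) : vertPart γ z (vertLift X) = X := by
  simp [vertPart_apply, vertLift]

theorem horLift_add_vertLift (v : E × E) :
    horLift γ z v.1 + vertLift (vertPart γ z v) = v := by
  ext <;> simp [vertPart_apply, horLift, vertLift]

theorem liftJ_horLift_eq (X : E) : liftJ γ κ z (horLift γ z X) = vertLift (opH γ κ z X) := by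
  ext <;> simp [liftJ, horLift, vertLift, horPart, vertPart, opH]

theorem liftJ_vertLift_eq (X : E) : liftJ γ κ z (vertLift X) = -horLift γ z (opV γ κ z X) := by
  ext <;> simp [liftJ, horLift, vertLift, horPart, vertPart, opV]

theorem vertPartDeriv_horLift (P X : E) :
    vertPartDeriv γ z (horLift γ z P) X = horDeriv γ z P X := by
  simp [vertPartDeriv, horDeriv, horLift, sub_eq_add_neg]

theorem vertPartDeriv_vertLift (P X : E) :
    vertPartDeriv γ z (vertLift P) X = christoffel γ z.1 X P := by
  simp [vertPartDeriv, vertLift]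

theorem vertPartDeriv_zero (p : E × E) : vertPartDeriv γ z p 0 = 0 := by
  simp [vertPartDeriv]

theorem opHDeriv_zero_left (X : E) : opHDeriv γ κ T z 0 X = 0 := by
  simp [opHDeriv, natEndDeriv]

theorem opVDeriv_zero_right (K : E) : opVDeriv γ κ T z K 0 = 0 := by
  simp [opVDeriv, natEndDeriv]

theorem formHDeriv_zero_left (X Y : E) : formHDeriv γ κ T z 0 X Y = 0 := by
  simp [formHDeriv, natFormDeriv]

theorem formHDeriv_zero_middle (K Y : E) : formHDeriv γ κ T z K 0 Y = 0 := by
  simp [formHDeriv, natFormDeriv]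

theorem formHDeriv_zero_right (K X : E) : formHDeriv γ κ T z K X 0 = 0 := by
  simp [formHDeriv, natFormDeriv]

theorem formVDeriv_zero_left (X Y : E) : formVDeriv γ κ T z 0 X Y = 0 := by
  simp [formVDeriv, natFormDeriv]

theorem formVDeriv_zero_middle (K Y : E) : formVDeriv γ κ T z K 0 Y = 0 := by
  simp [formVDeriv, natFormDeriv]

theorem formVDeriv_zero_right (K X : E) : formVDeriv γ κ T z K X 0 = 0 := by
  simp [formVDeriv, natFormDeriv]

theorem formHDeriv_neg_right (K X Y : E) :
    formHDeriv γ κ T z K X (-Y) = -formHDeriv γ κ T z K X Y := by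
  simp only [formHDeriv, natFormDeriv, map_neg, neg_apply]
  ring

theorem horDeriv_neg_right (P X : E) : horDeriv γ z P (-X) = -horDeriv γ z P X := by
  simp only [horDeriv, map_neg, neg_apply]
  abel

variable [FiniteDimensional ℝ E]

namespace IsMetricOn

theorem horDeriv_sub (hγ : IsMetricOn γ U) (hz : z.1 ∈ U) (X Y : E) :
    horDeriv γ z X Y - horDeriv γ z Y X = curvature γ z.1 X Y z.2 := by
  rw [hγ.curvature_eq hz, horDeriv, horDeriv]

theorem fderiv_liftJ_fst (hγ : IsMetricOn γ U) (hz : z ∈ tube γ U T)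
    (hκ : κ.SmoothOn (energyRange T)) (p v : E × E) :
    (fderiv ℝ (liftJ γ κ) z p v).1 =
      -(opV γ κ z (christoffel γ z.1 p.1 (vertPart γ z v) + vertPartDeriv γ z p v.1)
        - christoffel γ z.1 p.1 (opV γ κ z (vertPart γ z v))
        + opVDeriv γ κ T z (vertPart γ z p) (vertPart γ z v)) := by
  have hd := (hγ.contDiffAt_liftJ hz hκ).differentiableAt (by simp)
  have h1 := hasDerivAt_fst ((hd.hasDerivAt_line p).clm_apply (hasDerivAt_const (0 : ℝ) v))
  simp only [liftJ_fst] at h1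
  have h2 := (hγ.hasDerivAt_natEnd hz.1 p (hγ.hasDerivAt_comp_energy hz hκ.1.2 p)
    (hγ.hasDerivAt_comp_energy hz hκ.2.1.2 p)
    (hγ.hasDerivAt_vertPart hz.1 p (hasDerivAt_const (0 : ℝ) v))).neg
  have h3 := h1.unique h2
  simpa [opV, opVDeriv] using h3

/-- The vertical part of `J v` is `A` applied to the first component, which is easy to
differentiate. The projection `vertPart` itself varies with the point; the subtracted term corrects
for this. -/
theorem vertPart_fderiv_liftJ (hγ : IsMetricOn γ U) (hz : z ∈ tube γ U T)
    (hκ : κ.SmoothOn (energyRange T)) (p v : E × E) :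
    vertPart γ z (fderiv ℝ (liftJ γ κ) z p v) =
      opH γ κ z (christoffel γ z.1 p.1 v.1) - christoffel γ z.1 p.1 (opH γ κ z v.1)
        + opHDeriv γ κ T z (vertPart γ z p) v.1 - vertPartDeriv γ z p (liftJ γ κ z v).1 := by
  have hd := (hγ.contDiffAt_liftJ hz hκ).differentiableAt (by simp)
  have h1 := hγ.hasDerivAt_vertPart hz.1 p
    ((hd.hasDerivAt_line p).clm_apply (hasDerivAt_const (0 : ℝ) v))
  simp only [vertPart_liftJ] at h1
  have h2 := hγ.hasDerivAt_natEnd hz.1 p (hγ.hasDerivAt_comp_energy hz hκ.1.1 p)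
    (hγ.hasDerivAt_comp_energy hz hκ.2.1.1 p) (hasDerivAt_const (0 : ℝ) v.1)
  have h3 := h1.unique h2
  simp only [zero_smul, add_zero, map_zero] at h3
  rw [eq_sub_iff_add_eq, add_comm]
  exact h3

theorem fderiv_liftG (hγ : IsMetricOn γ U) (hz : z ∈ tube γ U T)
    (hκ : κ.SmoothOn (energyRange T)) (p v w : E × E) :
    fderiv ℝ (liftG γ κ) z p v w =
      formH γ κ z (christoffel γ z.1 p.1 v.1) w.1 + formH γ κ z v.1 (christoffel γ z.1 p.1 w.1)
      + formHDeriv γ κ T z (vertPart γ z p) v.1 w.1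
      + (formV γ κ z (christoffel γ z.1 p.1 (vertPart γ z v) + vertPartDeriv γ z p v.1)
          (vertPart γ z w)
        + formV γ κ z (vertPart γ z v)
          (christoffel γ z.1 p.1 (vertPart γ z w) + vertPartDeriv γ z p w.1)
        + formVDeriv γ κ T z (vertPart γ z p) (vertPart γ z v) (vertPart γ z w)) := by
  have hd := (hγ.contDiffAt_liftG hz hκ).differentiableAt (by simp)
  have h1 := ((hd.hasDerivAt_line p).clm_apply (hasDerivAt_const (0 : ℝ) v)).clm_apply
    (hasDerivAt_const (0 : ℝ) w)
  simp only [liftG_apply] at h1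
  have h2 := (hγ.hasDerivAt_natForm hz.1 p (hγ.hasDerivAt_comp_energy hz hκ.2.2.1.1 p)
    (hγ.hasDerivAt_comp_energy hz hκ.2.2.2.1 p) (hasDerivAt_const (0 : ℝ) v.1)
    (hasDerivAt_const (0 : ℝ) w.1)).add
    (hγ.hasDerivAt_natForm hz.1 p (hγ.hasDerivAt_comp_energy hz hκ.2.2.1.2 p)
    (hγ.hasDerivAt_comp_energy hz hκ.2.2.2.2 p)
    (hγ.hasDerivAt_vertPart hz.1 p (hasDerivAt_const (0 : ℝ) v))
    (hγ.hasDerivAt_vertPart hz.1 p (hasDerivAt_const (0 : ℝ) w)))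
  have h3 := h1.unique h2
  simp only [zero_smul, add_zero, map_zero, Prod.fst_zero] at h3
  exact h3

end IsMetricOn

end Lift

/-- `κ` defines an almost anti-Hermitian structure on the part of the tube over `U`. -/
structure IsNorden {E : Type*} [NormedAddCommGroup E] [NormedSpace ℝ E]
    (γ : E → E →L[ℝ] E →L[ℝ] ℝ) (κ : DiagonalCoeffs) (U : Set E) (T : EReal) : Prop where
  metric : IsMetricOn γ U
  smooth : κ.SmoothOn (energyRange T)
  sq : ∀ z ∈ tube γ U T, ∀ w, liftJ γ κ z (liftJ γ κ z w) = -w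
  nondegenerate : ∀ z ∈ tube γ U T, ∀ w, (∀ w', liftG γ κ z w w' = 0) → w = 0
  anti : ∀ z ∈ tube γ U T, ∀ w w',
    liftG γ κ z (liftJ γ κ z w) (liftJ γ κ z w') = -liftG γ κ z w w'

/-! ### Components of the Nijenhuis tensor and of the covariant derivative of `J` -/

section

variable {E : Type*} [NormedAddCommGroup E] [NormedSpace ℝ E]
  {γ : E → E →L[ℝ] E →L[ℝ] ℝ} {U : Set E} {T : EReal} {z : E × E} {κ : DiagonalCoeffs}

theorem liftG_eq (v w : E × E) : liftG γ κ z v w =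
    formH γ κ z v.1 w.1 + formV γ κ z (vertPart γ z v) (vertPart γ z w) := by
  rw [liftG_apply, formH, formV]

namespace IsNorden

theorem opV_opH (h : IsNorden γ κ U T) (hz : z ∈ tube γ U T) (X : E) :
    opV γ κ z (opH γ κ z X) = X := by
  have := congrArg Prod.fst (h.sq z hz (horLift γ z X))
  rw [liftJ_horLift_eq, liftJ_vertLift_eq] at this
  simpa [horLift_fst] using this

theorem opH_opV (h : IsNorden γ κ U T) (hz : z ∈ tube γ U T) (X : E) :
    opH γ κ z (opV γ κ z X) = X := by
  have := congrArg (vertPart γ z) (h.sq z hz (vertLift X))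
  rw [liftJ_vertLift_eq, map_neg, liftJ_horLift_eq] at this
  simpa [vertPart_vertLift] using this

theorem formV_opH_opH (h : IsNorden γ κ U T) (hz : z ∈ tube γ U T) (X Y : E) :
    formV γ κ z (opH γ κ z X) (opH γ κ z Y) = -formH γ κ z X Y := by
  have := h.anti z hz (horLift γ z X) (horLift γ z Y)
  simpa [liftJ_horLift_eq, liftG_eq, vertLift_fst, horLift_fst, vertPart_vertLift,
    vertPart_horLift] using this

theorem formH_opV (h : IsNorden γ κ U T) (hz : z ∈ tube γ U T) (X Y : E) :
    formH γ κ z (opV γ κ z X) Y = -formV γ κ z X (opH γ κ z Y) := by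
  have := h.formV_opH_opH hz (opV γ κ z X) Y
  rw [h.opH_opV hz] at this
  linarith

theorem pure (h : IsNorden γ κ U T) (hz : z ∈ tube γ U T) (v w : E × E) :
    liftG γ κ z (liftJ γ κ z v) w = liftG γ κ z v (liftJ γ κ z w) := by
  have := h.anti z hz v (liftJ γ κ z w)
  rw [h.sq z hz, map_neg] at this
  exact neg_injective this

theorem formV_symm (h : IsNorden γ κ U T) (hz : z ∈ tube γ U T) (X Y : E) :
    formV γ κ z X Y = formV γ κ z Y X := by
  rw [formV, natForm_apply, natForm_apply, h.metric.symm _ hz.1 X Y]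
  ring

theorem formH_symm (h : IsNorden γ κ U T) (hz : z ∈ tube γ U T) (X Y : E) :
    formH γ κ z X Y = formH γ κ z Y X := by
  rw [formH, natForm_apply, natForm_apply, h.metric.symm _ hz.1 X Y]
  ring

variable [FiniteDimensional ℝ E]

theorem differentiableAt_liftJ (h : IsNorden γ κ U T) (hz : z ∈ tube γ U T) :
    DifferentiableAt ℝ (liftJ γ κ) z :=
  (h.metric.contDiffAt_liftJ hz h.smooth).differentiableAt (by simp)

omit [FiniteDimensional ℝ E] in
theorem eventually_sq (h : IsNorden γ κ U T) (hz : z ∈ tube γ U T) :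
    ∀ᶠ w in nhds z, ∀ v, liftJ γ κ w (liftJ γ κ w v) = -v := by
  filter_upwards [h.metric.isOpen_tube.mem_nhds hz] with w hw using h.sq w hw

/-- The identity `formV_opH_opH` holds on the whole open tube and may be differentiated in the
direction `K^V`. -/
theorem formHDeriv_eq (h : IsNorden γ κ U T) (hz : z ∈ tube γ U T) (K X Y : E) :
    formHDeriv γ κ T z K X Y = -formVDeriv γ κ T z K (opH γ κ z X) (opH γ κ z Y)
      - formV γ κ z (opHDeriv γ κ T z K X) (opH γ κ z Y)
      - formV γ κ z (opH γ κ z X) (opHDeriv γ κ T z K Y) := by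
  have hγ := h.metric
  obtain ⟨⟨ha, -⟩, ⟨hb, -⟩, ⟨hc₁, hc₂⟩, ⟨hd₁, hd₂⟩⟩ := h.smooth
  -- Along a vertical line the base point is fixed, so all Christoffel terms drop out.
  set p : E × E := vertLift K with hp
  have hA : ∀ X, HasDerivAt (fun s : ℝ => opH γ κ (z + s • p) X) (opHDeriv γ κ T z K X) 0 := by
    intro X
    have := hγ.hasDerivAt_natEnd hz.1 p (hγ.hasDerivAt_comp_energy hz ha p)
      (hγ.hasDerivAt_comp_energy hz hb p) (hasDerivAt_const (0 : ℝ) X)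
    unfold opH opHDeriv
    simpa only [hp, zero_smul, add_zero, map_zero, zero_apply, sub_zero, zero_add, vertLift_fst,
      vertPart_vertLift] using this
  have hH := hγ.hasDerivAt_natForm hz.1 p (hγ.hasDerivAt_comp_energy hz hc₁ p)
    (hγ.hasDerivAt_comp_energy hz hd₁ p) (hasDerivAt_const (0 : ℝ) X)
    (hasDerivAt_const (0 : ℝ) Y)
  have hV := (hγ.hasDerivAt_natForm hz.1 p (hγ.hasDerivAt_comp_energy hz hc₂ p)
    (hγ.hasDerivAt_comp_energy hz hd₂ p) (hA X) (hA Y)).neg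
  have hc : Filter.Tendsto (fun s : ℝ => z + s • p) (nhds 0) (nhds z) := by
    have : Continuous fun s : ℝ => z + s • p := by fun_prop
    simpa using this.tendsto 0
  have heq := hH.unique (hV.congr_of_eventuallyEq (by
    filter_upwards [hc (hγ.isOpen_tube.mem_nhds hz)] with s hs
    have := h.formV_opH_opH hs X Y
    rw [formV, formH] at this
    simp only [Pi.neg_apply]
    rw [this, neg_neg]))
  simp only [hp, zero_smul, add_zero, map_zero, zero_apply, zero_add, vertLift_fst,
    vertPart_vertLift] at heq
  have heq' : formHDeriv γ κ T z K X Y = -(formV γ κ z (opHDeriv γ κ T z K X) (opH γ κ z Y)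
      + formV γ κ z (opH γ κ z X) (opHDeriv γ κ T z K Y)
      + formVDeriv γ κ T z K (opH γ κ z X) (opH γ κ z Y)) := heq
  rw [heq']
  ring

/-- The Nijenhuis tensor on horizontal lifts. -/
theorem nijenhuis_horLift (h : IsNorden γ κ U T) (hz : z ∈ tube γ U T) (X Y : E) :
    nijenhuis (liftJ γ κ) z (horLift γ z X) (horLift γ z Y) =
      vertLift (opHDeriv γ κ T z (opH γ κ z X) Y - opHDeriv γ κ T z (opH γ κ z Y) X
        + curvature γ z.1 X Y z.2) := by
  rw [nijenhuis_eq (h.differentiableAt_liftJ hz), ← h.metric.horDeriv_sub hz.1]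
  have h1 := h.metric.fderiv_liftJ_fst hz h.smooth
  have h2 := h.metric.vertPart_fderiv_liftJ hz h.smooth
  set N := fderiv ℝ (liftJ γ κ) z (liftJ γ κ z (horLift γ z X)) (horLift γ z Y)
    - fderiv ℝ (liftJ γ κ) z (liftJ γ κ z (horLift γ z Y)) (horLift γ z X)
      + liftJ γ κ z (fderiv ℝ (liftJ γ κ) z (horLift γ z Y) (horLift γ z X))
      - liftJ γ κ z (fderiv ℝ (liftJ γ κ) z (horLift γ z X) (horLift γ z Y)) with hN
  -- The horizontal component contains only Christoffel terms, which cancel by their symmetry.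
  have hfst : N.1 = 0 := by
    simp only [hN, Prod.fst_sub, Prod.fst_add, liftJ_horLift_eq, h1, liftJ_fst, h2,
      horLift_fst, vertLift_fst, vertPart_horLift, vertPart_vertLift,
      vertPartDeriv_vertLift, vertPartDeriv_zero, map_zero, opVDeriv_zero_right,
      opHDeriv_zero_left, zero_add, add_zero, sub_zero]
    change _ - _ + -(opV γ κ z _) - -(opV γ κ z _) = _
    simp only [map_sub, h.opV_opH hz, h.metric.christoffel_symm hz.1 Y X]
    abel
  have hvert : vertPart γ z N = opHDeriv γ κ T z (opH γ κ z X) Y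
      - opHDeriv γ κ T z (opH γ κ z Y) X + (horDeriv γ z X Y - horDeriv γ z Y X) := by
    simp only [hN, map_sub, map_add, liftJ_horLift_eq, h1, vertPart_liftJ, h2,
      horLift_fst, vertLift_fst, vertPart_horLift, vertPart_vertLift, vertPartDeriv_horLift,
      vertPartDeriv_zero, map_zero, zero_apply, opVDeriv_zero_right,
      zero_add, add_zero, sub_zero]
    change _ - _ + opH γ κ z _ - opH γ κ z _ = _
    simp only [map_neg, h.opH_opV hz]
    abel
  rw [← horLift_add_vertLift (γ := γ) (z := z) N, hfst, hvert, map_zero, zero_add]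

theorem metric_covDerivEnd (h : IsNorden γ κ U T) (hz : z ∈ tube γ U T) (u v w : E × E) :
    liftG γ κ z (covDerivEnd (liftG γ κ) (liftJ γ κ) z u v) w =
      liftG γ κ z (fderiv ℝ (liftJ γ κ) z u v) w
      + (fderiv ℝ (liftG γ κ) z u (liftJ γ κ z v) w + fderiv ℝ (liftG γ κ) z (liftJ γ κ z v) u w
        - fderiv ℝ (liftG γ κ) z w u (liftJ γ κ z v)) / 2
      - (fderiv ℝ (liftG γ κ) z u v (liftJ γ κ z w) + fderiv ℝ (liftG γ κ) z v u (liftJ γ κ z w)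
        - fderiv ℝ (liftG γ κ) z (liftJ γ κ z w) u v) / 2 :=
  AntiKahler.metric_covDerivEnd (h.nondegenerate z hz) (h.pure hz) u v w

/-- No derivative of a coefficient survives here, because `G` is block diagonal and `J` exchanges
the blocks; the remaining Christoffel terms cancel. The same happens in `metric_covDerivEnd_hhv`. -/
theorem metric_covDerivEnd_vhh (h : IsNorden γ κ U T) (hz : z ∈ tube γ U T) (X Y Z : E) :
    liftG γ κ z (covDerivEnd (liftG γ κ) (liftJ γ κ) z (vertLift X) (horLift γ z Y))
      (horLift γ z Z) = 0 := by
  have h1 := h.metric.fderiv_liftJ_fst hz h.smooth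
  have h2 := h.metric.vertPart_fderiv_liftJ hz h.smooth
  have h3 := h.metric.fderiv_liftG hz h.smooth
  rw [h.metric_covDerivEnd hz]
  simp only [liftG_eq, liftJ_horLift_eq, h1, h2, h3,
      horLift_fst, vertLift_fst, vertPart_horLift, vertPart_vertLift,
      vertPartDeriv_vertLift, vertPartDeriv_zero, map_zero, zero_apply, opVDeriv_zero_right,
      formHDeriv_zero_middle, formHDeriv_zero_right,
      formVDeriv_zero_left, formVDeriv_zero_middle, formVDeriv_zero_right, zero_add, add_zero,
      sub_zero, map_neg, neg_apply, h.formH_opV hz]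
  rw [h.formV_symm hz (opH γ κ z Y)]
  ring

theorem metric_covDerivEnd_hhv (h : IsNorden γ κ U T) (hz : z ∈ tube γ U T) (X Y Z : E) :
    liftG γ κ z (covDerivEnd (liftG γ κ) (liftJ γ κ) z (horLift γ z X) (horLift γ z Y))
      (vertLift (opH γ κ z Z)) = 0 := by
  have h1 := h.metric.fderiv_liftJ_fst hz h.smooth
  have h2 := h.metric.vertPart_fderiv_liftJ hz h.smooth
  have h3 := h.metric.fderiv_liftG hz h.smooth
  rw [h.metric_covDerivEnd hz]
  simp only [liftG_eq, liftJ_horLift_eq, liftJ_vertLift_eq, h1, h2, h3,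
      horLift_fst, vertLift_fst, vertPart_horLift, vertPart_vertLift, vertPartDeriv_horLift,
      vertPartDeriv_vertLift, vertPartDeriv_zero, map_zero, zero_apply, opVDeriv_zero_right,
      opHDeriv_zero_left, formHDeriv_zero_left, formHDeriv_zero_right,
      formVDeriv_zero_left, formVDeriv_zero_middle, formVDeriv_zero_right, zero_add, add_zero,
      sub_zero, map_neg, neg_apply, map_sub, sub_apply,
      h.opV_opH hz, Prod.fst_neg, neg_zero]
  rw [h.metric.christoffel_symm hz.1 Y X]
  rw [h.metric.christoffel_symm hz.1 Z X, h.metric.christoffel_symm hz.1 Z Y,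
    h.formH_symm hz (christoffel γ z.1 X Z), h.formV_opH_opH hz,
    h.formV_symm hz (opH γ κ z Y)]
  ring

theorem metric_covDerivEnd_hhh (h : IsNorden γ κ U T) (hz : z ∈ tube γ U T) (X Y Z : E) :
    2 * liftG γ κ z (covDerivEnd (liftG γ κ) (liftJ γ κ) z (horLift γ z X) (horLift γ z Y))
      (horLift γ z Z) =
    formHDeriv γ κ T z (opH γ κ z Y) X Z + formHDeriv γ κ T z (opH γ κ z Z) X Y
      + formV γ κ z (opH γ κ z Y) (curvature γ z.1 X Z z.2)
      + formV γ κ z (opH γ κ z Z) (curvature γ z.1 X Y z.2) := by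
  have h1 := h.metric.fderiv_liftJ_fst hz h.smooth
  have h2 := h.metric.vertPart_fderiv_liftJ hz h.smooth
  have h3 := h.metric.fderiv_liftG hz h.smooth
  rw [h.metric_covDerivEnd hz]
  simp only [liftG_eq, liftJ_horLift_eq, h1, h2, h3,
      horLift_fst, vertLift_fst, vertPart_horLift, vertPart_vertLift, vertPartDeriv_horLift,
      vertPartDeriv_vertLift, vertPartDeriv_zero, map_zero, zero_apply, opVDeriv_zero_right,
      opHDeriv_zero_left, formHDeriv_zero_middle, formHDeriv_zero_right,
      formVDeriv_zero_middle, formVDeriv_zero_right, zero_add, add_zero,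
      sub_zero, map_neg, neg_apply, map_sub,
      h.formH_opV hz, ← h.metric.horDeriv_sub hz.1]
  rw [h.formV_symm hz (opH γ κ z Y), h.formV_symm hz (opH γ κ z Y),
    h.formV_symm hz (opH γ κ z Z), h.formV_symm hz (opH γ κ z Z)]
  ring

/-- The test vector is `J Z^H`; as `A` is bijective, every vertical vector has this form. The
derivative of `formH` that appears is eliminated through `formHDeriv_eq`. -/
theorem metric_covDerivEnd_vhv (h : IsNorden γ κ U T) (hz : z ∈ tube γ U T) (X Y Z : E) :
    2 * liftG γ κ z (covDerivEnd (liftG γ κ) (liftJ γ κ) z (vertLift X) (horLift γ z Y))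
      (vertLift (opH γ κ z Z)) =
    formV γ κ z (opHDeriv γ κ T z X Y) (opH γ κ z Z)
      - formV γ κ z (opH γ κ z Y) (opHDeriv γ κ T z X Z)
      + formVDeriv γ κ T z (opH γ κ z Y) X (opH γ κ z Z)
      - formVDeriv γ κ T z (opH γ κ z Z) X (opH γ κ z Y)
      + formV γ κ z X (curvature γ z.1 Y Z z.2) := by
  have h1 := h.metric.fderiv_liftJ_fst hz h.smooth
  have h2 := h.metric.vertPart_fderiv_liftJ hz h.smooth
  have h3 := h.metric.fderiv_liftG hz h.smooth
  rw [h.metric_covDerivEnd hz]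
  simp only [liftG_eq, liftJ_horLift_eq, liftJ_vertLift_eq, h1, h2, h3,
      horLift_fst, vertLift_fst, vertPart_horLift, vertPart_vertLift, vertPartDeriv_horLift,
      vertPartDeriv_vertLift, vertPartDeriv_zero, map_zero, zero_apply, opVDeriv_zero_right,
      formHDeriv_zero_middle, formHDeriv_zero_right,
      formVDeriv_zero_right, zero_add, add_zero,
      sub_zero, map_neg, neg_apply, map_sub,
      h.opV_opH hz, Prod.fst_neg, neg_zero,
      formHDeriv_neg_right, horDeriv_neg_right,
      ← h.metric.horDeriv_sub hz.1]
  rw [h.formHDeriv_eq hz]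
  ring

end IsNorden

end

/-! ### Reduction of both conditions to tensor identities on the base -/

section

variable {E : Type*} [NormedAddCommGroup E] [NormedSpace ℝ E] [FiniteDimensional ℝ E]
  {γ : E → E →L[ℝ] E →L[ℝ] ℝ} {U : Set E} {T : EReal} {z : E × E} {κ : DiagonalCoeffs}

namespace IsNorden

omit [FiniteDimensional ℝ E] in
theorem exists_horLift_add_liftJ (h : IsNorden γ κ U T) (hz : z ∈ tube γ U T) (v : E × E) :
    ∃ X Y, v = horLift γ z X + liftJ γ κ z (horLift γ z Y) :=
  ⟨v.1, opV γ κ z (vertPart γ z v), by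
    rw [liftJ_horLift_eq, h.opH_opV hz, horLift_add_vertLift]⟩

/-- Horizontal vectors and their images under `J` span, and `N(Ju, v) = -J N(u, v)`, so with
antisymmetry the horizontal values determine `N`. -/
theorem nijenhuis_eq_zero_iff (h : IsNorden γ κ U T) (hz : z ∈ tube γ U T) :
    (∀ u v, nijenhuis (liftJ γ κ) z u v = 0) ↔ ∀ X Y,
      opHDeriv γ κ T z (opH γ κ z X) Y - opHDeriv γ κ T z (opH γ κ z Y) X
        + curvature γ z.1 X Y z.2 = 0 := by
  have hJ := h.differentiableAt_liftJ hz
  have hsq := h.eventually_sq hz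
  constructor
  · intro hN X Y
    have := congrArg (vertPart γ z) (h.nijenhuis_horLift hz X Y)
    rwa [hN, map_zero, vertPart_vertLift, eq_comm] at this
  · intro hR u v
    have hH : ∀ X Y, nijenhuis (liftJ γ κ) z (horLift γ z X) (horLift γ z Y) = 0 := by
      intro X Y
      rw [h.nijenhuis_horLift hz, hR, map_zero]
    have hadd : ∀ u u' v, nijenhuis (liftJ γ κ) z (u + u') v =
        nijenhuis (liftJ γ κ) z u v + nijenhuis (liftJ γ κ) z u' v := by
      intro u u' v
      simp only [nijenhuis_eq hJ, map_add, add_apply]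
      abel
    have hl : ∀ u Y, nijenhuis (liftJ γ κ) z u (horLift γ z Y) = 0 := by
      intro u Y
      obtain ⟨X, X', rfl⟩ := h.exists_horLift_add_liftJ hz u
      rw [hadd, nijenhuis_apply_left hJ hsq, hH, hH, map_zero, neg_zero, add_zero]
    obtain ⟨Y, Y', rfl⟩ := h.exists_horLift_add_liftJ hz v
    rw [nijenhuis_antisymm hJ, hadd, nijenhuis_apply_left hJ hsq,
      nijenhuis_antisymm hJ _ u, nijenhuis_antisymm hJ _ u, hl, hl]
    simp

/-- Since `∇J` anticommutes with `J`, a horizontal second argument suffices. Nondegeneracy of `G`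
then reduces the claim to four families of components, two of which vanish identically. -/
theorem covDerivEnd_eq_zero_iff (h : IsNorden γ κ U T) (hz : z ∈ tube γ U T) :
    (∀ u v, covDerivEnd (liftG γ κ) (liftJ γ κ) z u v = 0) ↔
      (∀ X Y Z, formHDeriv γ κ T z (opH γ κ z Y) X Z + formHDeriv γ κ T z (opH γ κ z Z) X Y
        + formV γ κ z (opH γ κ z Y) (curvature γ z.1 X Z z.2)
        + formV γ κ z (opH γ κ z Z) (curvature γ z.1 X Y z.2) = 0) ∧
      (∀ X Y Z, formV γ κ z (opHDeriv γ κ T z X Y) (opH γ κ z Z)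
        - formV γ κ z (opH γ κ z Y) (opHDeriv γ κ T z X Z)
        + formVDeriv γ κ T z (opH γ κ z Y) X (opH γ κ z Z)
        - formVDeriv γ κ T z (opH γ κ z Z) X (opH γ κ z Y)
        + formV γ κ z X (curvature γ z.1 Y Z z.2) = 0) := by
  have hJ := h.differentiableAt_liftJ hz
  have hsq := h.eventually_sq hz
  constructor
  · intro hcov
    refine ⟨fun X Y Z => ?_, fun X Y Z => ?_⟩
    · rw [← h.metric_covDerivEnd_hhh hz, hcov, map_zero, zero_apply, mul_zero]
    · rw [← h.metric_covDerivEnd_vhv hz, hcov, map_zero, zero_apply, mul_zero]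
  · rintro ⟨h1, h3⟩
    have hnd : ∀ u Y, (∀ Z, liftG γ κ z (covDerivEnd (liftG γ κ) (liftJ γ κ) z u (horLift γ z Y))
          (horLift γ z Z) = 0) → (∀ Z, liftG γ κ z (covDerivEnd (liftG γ κ) (liftJ γ κ) z u
          (horLift γ z Y)) (vertLift (opH γ κ z Z)) = 0) →
        covDerivEnd (liftG γ κ) (liftJ γ κ) z u (horLift γ z Y) = 0 := by
      intro u Y hh hv
      refine h.nondegenerate z hz _ fun w => ?_
      obtain ⟨Z, Z', rfl⟩ := h.exists_horLift_add_liftJ hz w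
      rw [map_add, liftJ_horLift_eq, hh, hv, add_zero]
    have hu : ∀ u Y, covDerivEnd (liftG γ κ) (liftJ γ κ) z u (horLift γ z Y) = 0 := by
      intro u Y
      have hH : ∀ X, covDerivEnd (liftG γ κ) (liftJ γ κ) z (horLift γ z X) (horLift γ z Y) = 0 :=
        fun X => hnd _ _ (fun Z => by
          have := h.metric_covDerivEnd_hhh hz X Y Z
          rw [h1] at this
          linarith) fun Z => h.metric_covDerivEnd_hhv hz X Y Z
      have hV : ∀ X, covDerivEnd (liftG γ κ) (liftJ γ κ) z (vertLift X) (horLift γ z Y) = 0 :=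
        fun X => hnd _ _ (fun Z => h.metric_covDerivEnd_vhh hz X Y Z) fun Z => by
          have := h.metric_covDerivEnd_vhv hz X Y Z
          rw [h3] at this
          linarith
      have hadd : ∀ u u' v, covDerivEnd (liftG γ κ) (liftJ γ κ) z (u + u') v =
          covDerivEnd (liftG γ κ) (liftJ γ κ) z u v
            + covDerivEnd (liftG γ κ) (liftJ γ κ) z u' v := by
        intro u u' v
        simp only [covDerivEnd, map_add, add_apply]
        abel
      rw [← horLift_add_vertLift (γ := γ) (z := z) u, hadd, hH, hV, add_zero]
    intro u v
    obtain ⟨Y, Y', rfl⟩ := h.exists_horLift_add_liftJ hz v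
    have hadd : covDerivEnd (liftG γ κ) (liftJ γ κ) z u
        (horLift γ z Y + liftJ γ κ z (horLift γ z Y')) =
        covDerivEnd (liftG γ κ) (liftJ γ κ) z u (horLift γ z Y)
          + covDerivEnd (liftG γ κ) (liftJ γ κ) z u (liftJ γ κ z (horLift γ z Y')) := by
      simp only [covDerivEnd, map_add]
      abel
    rw [hadd, covDerivEnd_apply_comp_self hJ hsq, hu, hu, map_zero, neg_zero, add_zero]

theorem nijenhuis_eq_zero (h : IsNorden γ κ U T) (hz : z ∈ tube γ U T)
    (hcov : ∀ u v, covDerivEnd (liftG γ κ) (liftJ γ κ) z u v = 0) (u v : E × E) :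
    nijenhuis (liftJ γ κ) z u v = 0 := by
  refine nijenhuis_eq_zero_of_covDerivEnd (h.differentiableAt_liftJ hz) (h.sq z hz) ?_ hcov u v
  refine christoffel_symm_of_eventually
    ((h.metric.contDiffAt_liftG hz h.smooth).differentiableAt (by simp)) ?_
  filter_upwards [h.metric.isOpen_tube.mem_nhds hz] with w hw u v
  rw [liftG_eq, liftG_eq, h.formH_symm hw, h.formV_symm hw]

end IsNorden

/-- The function `a₁ a₁' - b₁ (a₁ - 2 t a₁')`. -/
def curvatureFun (κ : DiagonalCoeffs) (T : EReal) (t : ℝ) : ℝ :=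
  κ.a₁ t * derivWithin κ.a₁ (energyRange T) t
    - κ.b₁ t * (κ.a₁ t - 2 * t * derivWithin κ.a₁ (energyRange T) t)

omit [FiniteDimensional ℝ E] in
theorem metric_self_eq_energy (z : E × E) : γ z.1 z.2 z.2 = 2 * energy γ z := by
  rw [energy]; ring

omit [FiniteDimensional ℝ E] in
-- The terms with `b₁'` and with `g(A X, Y) y` are symmetric in `X`, `Y` and disappear; what is left
-- has the shape of a space-form curvature.
theorem IsMetricOn.opHDeriv_opH_sub (hγ : IsMetricOn γ U) (hz : z.1 ∈ U) (X Y : E) :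
    opHDeriv γ κ T z (opH γ κ z X) Y - opHDeriv γ κ T z (opH γ κ z Y) X =
      -(curvatureFun κ T (energy γ z) • (γ z.1 Y z.2 • X - γ z.1 X z.2 • Y)) := by
  have hs := hγ.symm _ hz
  simp only [opHDeriv, natEndDeriv, opH, natEnd_apply, map_add, map_smul, add_apply, smul_apply,
    smul_eq_mul, metric_self_eq_energy, curvatureFun, hs Y X]
  module

omit [FiniteDimensional ℝ E] in
/-- On a space form, the first family of equations of the anti-Kähler condition. -/
theorem IsMetricOn.horizontal_equation (hγ : IsMetricOn γ U) (hz : z.1 ∈ U) {c : ℝ}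
    (hR : ∀ X Y, curvature γ z.1 X Y z.2 = c • (γ z.1 Y z.2 • X - γ z.1 X z.2 • Y))
    {t a b c₂ d₁ c₁' d₁' : ℝ} (ht : energy γ z = t) (ha : κ.a₁ t = a) (hb : κ.b₁ t = b)
    (hc₂ : κ.c₂ t = c₂) (hd₁ : κ.d₁ t = d₁) (hc₁' : derivWithin κ.c₁ (energyRange T) t = c₁')
    (hd₁' : derivWithin κ.d₁ (energyRange T) t = d₁') (X Y Z : E) :
    formHDeriv γ κ T z (opH γ κ z Y) X Z + formHDeriv γ κ T z (opH γ κ z Z) X Y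
        + formV γ κ z (opH γ κ z Y) (curvature γ z.1 X Z z.2)
        + formV γ κ z (opH γ κ z Z) (curvature γ z.1 X Y z.2) =
      ((a + 2 * t * b) * c₁' + a * d₁ + c * c₂ * a)
          * (γ z.1 Y z.2 * γ z.1 X Z + γ z.1 Z z.2 * γ z.1 X Y)
        + 2 * a * (d₁ - c * c₂) * γ z.1 X z.2 * γ z.1 Y Z
        + (2 * (a + 2 * t * b) * d₁' + 4 * b * d₁)
          * (γ z.1 X z.2 * γ z.1 Y z.2 * γ z.1 Z z.2) := by
  have hs := hγ.symm _ hz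
  have hyy := metric_self_eq_energy (γ := γ) z
  rw [ht] at hyy
  simp only [hR, formHDeriv, natFormDeriv, opH, formV, natEnd_apply, natForm_apply, map_add,
    map_sub, map_smul, add_apply, smul_apply, smul_eq_mul, ht, hyy, ha, hb, hc₂, hd₁,
    hc₁', hd₁', hs z.2 X, hs z.2 Y, hs z.2 Z, hs Y X, hs Z X, hs Z Y]
  ring

omit [FiniteDimensional ℝ E] in
/-- On a space form, the second family of equations of the anti-Kähler condition. -/
theorem IsMetricOn.vertical_equation (hγ : IsMetricOn γ U) (hz : z.1 ∈ U) {c : ℝ}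
    (hR : ∀ X Y, curvature γ z.1 X Y z.2 = c • (γ z.1 Y z.2 • X - γ z.1 X z.2 • Y))
    {t a b c₂ d₂ c₂' : ℝ} (ht : energy γ z = t) (ha : κ.a₁ t = a) (hb : κ.b₁ t = b)
    (hc₂ : κ.c₂ t = c₂) (hd₂ : κ.d₂ t = d₂) (hc₂' : derivWithin κ.c₂ (energyRange T) t = c₂')
    (X Y Z : E) :
    formV γ κ z (opHDeriv γ κ T z (opH γ κ z X) Y) (opH γ κ z Z)
        - formV γ κ z (opH γ κ z Y) (opHDeriv γ κ T z (opH γ κ z X) Z)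
        + formVDeriv γ κ T z (opH γ κ z Y) (opH γ κ z X) (opH γ κ z Z)
        - formVDeriv γ κ T z (opH γ κ z Z) (opH γ κ z X) (opH γ κ z Y)
        + formV γ κ z (opH γ κ z X) (curvature γ z.1 Y Z z.2) =
      (2 * t * (c₂ * b + d₂ * (a + 2 * t * b)) * b * a - (a + 2 * t * b) * a ^ 2 * c₂'
          + d₂ * (a + 2 * t * b) * a ^ 2 + c * c₂ * a)
        * (γ z.1 X Y * γ z.1 Z z.2 - γ z.1 X Z * γ z.1 Y z.2) := by
  have hs := hγ.symm _ hz
  have hyy := metric_self_eq_energy (γ := γ) z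
  rw [ht] at hyy
  simp only [hR, formVDeriv, natFormDeriv, opHDeriv, natEndDeriv, opH, formV, natEnd_apply,
    natForm_apply, map_add, map_sub, map_smul, add_apply, smul_apply, smul_eq_mul, ht,
    hyy, ha, hb, hc₂, hd₂, hc₂', hs z.2 X, hs z.2 Y, hs z.2 Z, hs Y X, hs Z X, hs Z Y]
  ring

end

/-! ### Calculus on the interval `[0, T)` -/

section EnergyRange

variable {T : EReal}

theorem energyRange_Icc_subset {t : ℝ} (ht : t ∈ energyRange T) : Set.Icc 0 t ⊆ energyRange T :=
  fun _ hr => ⟨hr.1, lt_of_le_of_lt (EReal.coe_le_coe_iff.2 hr.2) ht.2⟩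

theorem exists_pos_mem_energyRange (hT : 0 < T) : ∃ r ∈ energyRange T, 0 < r := by
  obtain ⟨r, hr0, hrT⟩ := EReal.lt_iff_exists_real_btwn.1 hT
  have hr : 0 < r := by exact_mod_cast hr0
  exact ⟨r, ⟨hr.le, hrT⟩, hr⟩

theorem energyRange_mem_nhds {t : ℝ} (ht : t ∈ energyRange T) (h0 : 0 < t) :
    energyRange T ∈ nhds t := by
  filter_upwards [Ioi_mem_nhds h0,
    continuous_coe_real_ereal.continuousAt (Iio_mem_nhds ht.2)] with r hr hrT
  exact ⟨(Set.mem_Ioi.1 hr).le, hrT⟩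

theorem uniqueDiffOn_energyRange (hT : 0 < T) : UniqueDiffOn ℝ (energyRange T) := by
  refine uniqueDiffOn_convex (Set.OrdConnected.convex ⟨fun s hs t ht r hr => ?_⟩) ?_
  · exact energyRange_Icc_subset ht ⟨hs.1.trans hr.1, hr.2⟩
  · obtain ⟨r, hr, hr0⟩ := exists_pos_mem_energyRange hT
    exact ⟨r, mem_interior_iff_mem_nhds.2 (energyRange_mem_nhds hr hr0)⟩

/-- Testing on tangent vectors gives information only where `y ≠ 0`; the value at `0` follows by
continuity. -/
theorem eqOn_energyRange_of_pos (hT : 0 < T) {f g : ℝ → ℝ}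
    (hf : ContinuousOn f (energyRange T)) (hg : ContinuousOn g (energyRange T))
    (h : ∀ t ∈ energyRange T, 0 < t → f t = g t) : Set.EqOn f g (energyRange T) := by
  intro t ht
  rcases ht.1.eq_or_lt with rfl | h0
  · obtain ⟨r, hr, hr0⟩ := exists_pos_mem_energyRange hT
    have hsub := energyRange_Icc_subset hr
    have key : Set.EqOn f g (Set.Ioc 0 r) := fun s hs => h s (hsub ⟨hs.1.le, hs.2⟩) hs.1
    exact key.of_subset_closure (hf.mono hsub) (hg.mono hsub) Set.Ioc_subset_Icc_self
      (by rw [closure_Ioc hr0.ne]) ⟨le_rfl, hr0.le⟩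
  · exact h t ht h0

theorem continuousOn_derivWithin_energyRange (hT : 0 < T) {f : ℝ → ℝ}
    (hf : ContDiffOn ℝ ∞ f (energyRange T)) :
    ContinuousOn (derivWithin f (energyRange T)) (energyRange T) :=
  hf.continuousOn_derivWithin (uniqueDiffOn_energyRange hT) (by simp)

theorem hasDerivWithinAt_energyRange {f : ℝ → ℝ} (hf : ContDiffOn ℝ ∞ f (energyRange T)) {t : ℝ}
    (ht : t ∈ energyRange T) :
    HasDerivWithinAt f (derivWithin f (energyRange T) t) (energyRange T) t :=
  (hf.differentiableOn (by simp) t ht).hasDerivWithinAt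

/-- A solution of a homogeneous linear equation which does not vanish at `0` vanishes nowhere. -/
theorem ne_zero_of_linear_ode {h h' q : ℝ → ℝ} (hq : ContinuousOn q (energyRange T))
    (hd : ∀ t ∈ energyRange T, HasDerivWithinAt h (h' t) (energyRange T) t)
    (hode : ∀ t ∈ energyRange T, h' t = q t * h t) (h0 : h 0 ≠ 0) {t : ℝ}
    (ht : t ∈ energyRange T) : h t ≠ 0 := by
  intro hzero
  have hsub := energyRange_Icc_subset ht
  obtain ⟨K, hK⟩ := isCompact_Icc.exists_bound_of_continuousOn (hq.mono hsub)
  have hK' : ∀ s ∈ Set.Ioc 0 t, ‖q s‖₊ ≤ K.toNNReal := by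
    intro s hs
    rw [← NNReal.coe_le_coe, coe_nnnorm]
    exact (hK s ⟨hs.1.le, hs.2⟩).trans (Real.le_coe_toNNReal K)
  -- Uniqueness is run backwards from `t`: a zero at `t` would make `h` vanish on all of `[0, t]`.
  have := ODE_solution_unique_of_mem_Icc_left (v := fun s x => q s * x) (K := K.toNNReal)
    (s := fun _ => Set.univ) (f := h) (g := fun _ => 0) (a := 0) (b := t)
    (fun s hs => by
      refine LipschitzWith.lipschitzOnWith (LipschitzWith.of_dist_le_mul fun x y => ?_)
      rw [Real.dist_eq, ← mul_sub, abs_mul, ← Real.dist_eq x y]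
      exact mul_le_mul_of_nonneg_right (hK' s hs) dist_nonneg)
    (fun s hs => ((hd s (hsub hs)).continuousWithinAt).mono hsub)
    (fun s hs => by
      have hs' := hsub ⟨hs.1.le, hs.2⟩
      rw [← hode s hs']
      exact ((hd s hs').hasDerivAt (energyRange_mem_nhds hs' hs.1)).hasDerivWithinAt)
    (fun _ _ => trivial) continuousOn_const
    (fun s _ => by simpa using hasDerivWithinAt_const s (Set.Iic s) (0 : ℝ))
    (fun _ _ => trivial) hzero
  exact h0 (this ⟨le_rfl, ht.1⟩)

end EnergyRange

/-! ### Relations between the coefficient functions -/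

section Scalar

variable {T : EReal} {κ : DiagonalCoeffs}

theorem mul_eq_of_curvatureFun_eq {c t : ℝ} (hf : curvatureFun κ T t = c) :
    (κ.a₁ t + 2 * t * κ.b₁ t) * (κ.a₁ t - 2 * t * derivWithin κ.a₁ (energyRange T) t) =
      κ.a₁ t ^ 2 - 2 * c * t := by
  rw [← hf, curvatureFun]
  ring

/-- With `h = a₁² - 2 c t`, the equation `f = c` reads `h' = 2 b₁ (a₁ - 2 t a₁')`, and `h = (a₁ + 2
t b₁) (a₁ - 2 t a₁')`. Hence `h' = q h` with `q = 2 b₁ / (a₁ + 2 t b₁)`, which is continuous, while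
`h 0 = a₁(0)² ≠ 0`. -/
theorem sq_sub_ne_zero_of_curvatureFun_eq {c : ℝ} (hκ : κ.SmoothOn (energyRange T))
    (ha : ∀ t ∈ energyRange T, κ.a₁ t ≠ 0)
    (hα : ∀ t ∈ energyRange T, κ.a₁ t + 2 * t * κ.b₁ t ≠ 0)
    (hf : ∀ t ∈ energyRange T, curvatureFun κ T t = c) {t : ℝ} (ht : t ∈ energyRange T) :
    κ.a₁ t ^ 2 - 2 * c * t ≠ 0 := by
  have h0 : (0 : ℝ) ∈ energyRange T := energyRange_Icc_subset ht ⟨le_rfl, ht.1⟩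
  refine ne_zero_of_linear_ode (h := fun t => κ.a₁ t ^ 2 - 2 * c * t)
    (h' := fun t => 2 * κ.a₁ t * derivWithin κ.a₁ (energyRange T) t - 2 * c)
    (q := fun t => 2 * κ.b₁ t / (κ.a₁ t + 2 * t * κ.b₁ t)) ?_ ?_ ?_ ?_ ht
  · have h1 := hκ.1.1.continuousOn
    have h2 := hκ.2.1.1.continuousOn
    exact (h2.const_mul 2).div (h1.add ((continuousOn_id.const_mul 2).mul h2)) hα
  · intro s hs
    have h1 := ((hasDerivWithinAt_energyRange hκ.1.1 hs).pow 2).sub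
      ((hasDerivWithinAt_id s (energyRange T)).const_mul (2 * c))
    convert! h1 using 1
    simp
  · intro s hs
    have hα' := hα s hs
    have := hf s hs
    rw [curvatureFun] at this
    rw [div_mul_eq_mul_div, eq_div_iff hα']
    linear_combination (2 * κ.a₁ s) * this
  · simpa using ha 0 h0

theorem integrabilityFormula_of_curvatureFun_eq {c : ℝ} (hκ : κ.SmoothOn (energyRange T))
    (ha : ∀ t ∈ energyRange T, κ.a₁ t ≠ 0)
    (hα : ∀ t ∈ energyRange T, κ.a₁ t + 2 * t * κ.b₁ t ≠ 0)
    (hf : ∀ t ∈ energyRange T, curvatureFun κ T t = c) : IntegrabilityFormula T κ c := by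
  intro t ht
  have h1 := sq_sub_ne_zero_of_curvatureFun_eq hκ ha hα hf ht
  rw [← mul_eq_of_curvatureFun_eq (hf t ht)] at h1
  have h2 := right_ne_zero_of_mul h1
  refine ⟨h2, ?_⟩
  rw [eq_div_iff h2, ← hf t ht, curvatureFun]
  ring

theorem IntegrabilityFormula.curvatureFun_eq {c : ℝ} (h : IntegrabilityFormula T κ c) {t : ℝ}
    (ht : t ∈ energyRange T) : curvatureFun κ T t = c := by
  obtain ⟨h1, h2⟩ := h t ht
  rw [eq_div_iff h1] at h2
  rw [curvatureFun, h2]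
  ring

/-- The algebraic relations between the coefficients of an almost anti-Hermitian structure. -/
structure DiagonalCoeffs.IsNorden (κ : DiagonalCoeffs) (T : EReal) : Prop where
  smooth : κ.SmoothOn (energyRange T)
  a_mul : ∀ t ∈ energyRange T, κ.a₁ t * κ.a₂ t = 1
  radial_ne_zero : ∀ t ∈ energyRange T, κ.a₁ t + 2 * t * κ.b₁ t ≠ 0
  c₁_eq : ∀ t ∈ energyRange T, κ.c₁ t = -κ.a₁ t ^ 2 * κ.c₂ t
  radial_eq : ∀ t ∈ energyRange T, κ.c₁ t + 2 * t * κ.d₁ t =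
    -(κ.a₁ t + 2 * t * κ.b₁ t) ^ 2 * (κ.c₂ t + 2 * t * κ.d₂ t)

namespace DiagonalCoeffs.IsNorden

theorem a₁_ne_zero (h : κ.IsNorden T) {t : ℝ} (ht : t ∈ energyRange T) : κ.a₁ t ≠ 0 :=
  left_ne_zero_of_mul (by rw [h.a_mul t ht]; exact one_ne_zero)

theorem deriv_c₁ (h : κ.IsNorden T) (hT : 0 < T) {t : ℝ} (ht : t ∈ energyRange T) :
    derivWithin κ.c₁ (energyRange T) t =
      -2 * κ.a₁ t * derivWithin κ.a₁ (energyRange T) t * κ.c₂ t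
        - κ.a₁ t ^ 2 * derivWithin κ.c₂ (energyRange T) t := by
  have h1 := ((hasDerivWithinAt_energyRange h.smooth.1.1 ht).pow 2).neg.mul
    (hasDerivWithinAt_energyRange h.smooth.2.2.1.2 ht)
  have h2 := (h1.congr (f₁ := κ.c₁) (fun s hs => by simpa using h.c₁_eq s hs)
    (by simpa using h.c₁_eq t ht)).derivWithin
    (uniqueDiffOn_energyRange hT t ht)
  rw [h2]
  simp
  ring

/-- `c₁' (a₁ + 2 t b₁) a₁ = 2 c c₁` is the equation for `c₁'` in `MetricFormulas`. -/
theorem metricFormulas_iff (h : κ.IsNorden T) {c : ℝ}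
    (hf : ∀ t ∈ energyRange T, curvatureFun κ T t = c) :
    MetricFormulas T κ c ↔ ∀ t ∈ energyRange T,
      (κ.a₁ t + 2 * t * κ.b₁ t) * derivWithin κ.c₁ (energyRange T) t + κ.a₁ t * κ.d₁ t
        + c * κ.c₂ t * κ.a₁ t = 0 ∧ κ.d₁ t = c * κ.c₂ t := by
  refine forall₂_congr fun t ht => ?_
  have hne := sq_sub_ne_zero_of_curvatureFun_eq h.smooth (fun t ht => h.a₁_ne_zero ht)
    h.radial_ne_zero hf ht
  have hmul := mul_eq_of_curvatureFun_eq (hf t ht)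
  have ha := h.a₁_ne_zero ht
  have hα := h.radial_ne_zero t ht
  have hδ : κ.a₁ t - 2 * t * derivWithin κ.a₁ (energyRange T) t ≠ 0 := by
    rw [← hmul] at hne
    exact right_ne_zero_of_mul hne
  have hc₁ := h.c₁_eq t ht
  have hδ' : κ.a₁ t - 2 * derivWithin κ.a₁ (energyRange T) t * t =
      κ.a₁ t - 2 * t * derivWithin κ.a₁ (energyRange T) t := by ring
  rw [hδ', ← hmul]
  constructor
  · rintro ⟨-, h1, h2, -⟩
    refine ⟨?_, h2⟩
    rw [h1, h2, hc₁]
    field_simp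
    ring
  · rintro ⟨h1, h2⟩
    refine ⟨fun heq => hne (by linarith), ?_, h2, ?_⟩
    · rw [eq_div_iff (mul_ne_zero ha (mul_ne_zero hα hδ)), hc₁]
      rw [h2] at h1
      linear_combination
        (κ.a₁ t * (κ.a₁ t - 2 * t * derivWithin κ.a₁ (energyRange T) t)) * h1
    · rw [h2, hc₁]
      field_simp

/-- Differentiating `c₁ = -a₁² c₂` eliminates `c₁'`, and `f = c` eliminates `a₁'`. These relations
serve the components that the two equations for `c₁'` and `d₁` do not control directly. -/
theorem deriv_relations (h : κ.IsNorden T) (hT : 0 < T) {c : ℝ}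
    (hf : ∀ t ∈ energyRange T, curvatureFun κ T t = c)
    (hm : ∀ t ∈ energyRange T,
      (κ.a₁ t + 2 * t * κ.b₁ t) * derivWithin κ.c₁ (energyRange T) t + κ.a₁ t * κ.d₁ t
        + c * κ.c₂ t * κ.a₁ t = 0 ∧ κ.d₁ t = c * κ.c₂ t) {t : ℝ} (ht : t ∈ energyRange T) :
    (κ.a₁ t + 2 * t * κ.b₁ t) * derivWithin κ.c₂ (energyRange T) t = -2 * κ.b₁ t * κ.c₂ t ∧
    derivWithin κ.d₁ (energyRange T) t = c * derivWithin κ.c₂ (energyRange T) t := by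
  constructor
  · obtain ⟨h1, h2⟩ := hm t ht
    have h3 := hf t ht
    rw [h2, h.deriv_c₁ hT ht] at h1
    rw [curvatureFun] at h3
    have ha := pow_ne_zero 2 (h.a₁_ne_zero ht)
    refine mul_left_cancel₀ ha ?_
    linear_combination -h1 - (2 * κ.a₁ t * κ.c₂ t) * h3
  · exact (((hasDerivWithinAt_energyRange h.smooth.2.2.1.2 ht).const_mul c).congr
      (fun s hs => (hm s hs).2) (hm t ht).2).derivWithin (uniqueDiffOn_energyRange hT t ht)

end DiagonalCoeffs.IsNorden

end Scalar

/-! ### From tensor identities to equations for the coefficients -/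

section

variable {E : Type*} [NormedAddCommGroup E] [NormedSpace ℝ E]
  {γ : E → E →L[ℝ] E →L[ℝ] ℝ} {U : Set E} {T : EReal} {z : E × E} {x : E} {κ : DiagonalCoeffs}

theorem energy_smul (x y : E) (s : ℝ) : energy γ (x, s • y) = s ^ 2 * energy γ (x, y) := by
  simp only [energy, map_smul, smul_apply, smul_eq_mul]
  ring

theorem IsMetricOn.energy_pos (hγ : IsMetricOn γ U) (hx : x ∈ U) {y : E} (hy : y ≠ 0) :
    0 < energy γ (x, y) :=
  div_pos (hγ.pos x hx y hy) two_pos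

theorem IsMetricOn.exists_energy_smul_eq (hγ : IsMetricOn γ U) (hx : x ∈ U) {y : E} (hy : y ≠ 0)
    {t : ℝ} (ht : 0 ≤ t) : ∃ s : ℝ, energy γ (x, s • y) = t := by
  have hpos := hγ.energy_pos hx hy
  refine ⟨Real.sqrt (t / energy γ (x, y)), ?_⟩
  rw [energy_smul, Real.sq_sqrt (div_nonneg ht hpos.le)]
  field_simp

/-- In dimension at least two there are vectors of any energy together with a nonzero vector
orthogonal to them. -/
theorem IsMetricOn.exists_energy_eq_and_orthogonal [FiniteDimensional ℝ E] (hγ : IsMetricOn γ U)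
    (hx : x ∈ U) (hE : 2 ≤ Module.finrank ℝ E) {t : ℝ} (ht : 0 ≤ t) :
    ∃ y v, energy γ (x, y) = t ∧ v ≠ 0 ∧ γ x y v = 0 := by
  have : Nontrivial E := Module.nontrivial_of_finrank_pos (R := ℝ) (by omega)
  obtain ⟨w, hw⟩ := exists_ne (0 : E)
  obtain ⟨s, hs⟩ := hγ.exists_energy_smul_eq hx hw ht
  have hker : LinearMap.ker (γ x (s • w) : E →ₗ[ℝ] ℝ) ≠ ⊥ :=
    LinearMap.ker_ne_bot_of_finrank_lt (by rw [Module.finrank_self]; omega)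
  obtain ⟨v, hv, hv0⟩ := Submodule.exists_mem_ne_zero_of_ne_bot hker
  exact ⟨s • w, v, hs, hv0, hv⟩

theorem natEnd_apply_orthogonal {α β : ℝ} {X : E} (hX : γ z.1 X z.2 = 0) :
    natEnd γ z α β X = α • X := by
  rw [natEnd_apply, hX, mul_zero, zero_smul, add_zero]

theorem natEnd_apply_self (α β : ℝ) :
    natEnd γ z α β z.2 = (α + 2 * energy γ z * β) • z.2 := by
  rw [natEnd_apply, metric_self_eq_energy, ← add_smul]
  ring_nf

namespace IsNorden

/-- The identities for `J` and `G` are evaluated on `y` and on a vector orthogonal to `y`. At `t =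
0`, where `y = 0`, the radial relations coincide with the transversal ones. -/
theorem coeffs [FiniteDimensional ℝ E] (h : IsNorden γ κ U T) (hx : x ∈ U)
    (hE : 2 ≤ Module.finrank ℝ E) : κ.IsNorden T := by
  have hγ := h.metric
  have hpt : ∀ t ∈ energyRange T, ∃ z ∈ tube γ U T, energy γ z = t ∧
      ∃ v, v ≠ 0 ∧ γ z.1 v z.2 = 0 ∧ 0 < γ z.1 v v := by
    intro t ht
    obtain ⟨y, v, hy, hv, hyv⟩ := hγ.exists_energy_eq_and_orthogonal hx hE ht.1
    exact ⟨(x, y), ⟨hx, by rw [hy]; exact ht.2⟩, hy, v, hv, by rw [hγ.symm x hx]; exact hyv,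
      hγ.pos x hx v hv⟩
  have hmul : ∀ t ∈ energyRange T, κ.a₁ t * κ.a₂ t = 1 := by
    intro t ht
    obtain ⟨z, hz, rfl, v, hv, hvy, -⟩ := hpt t ht
    have h1 := h.opV_opH hz v
    rw [opV, opH, natEnd_apply_orthogonal hvy, map_smul, natEnd_apply_orthogonal hvy, smul_smul]
      at h1
    exact smul_left_injective ℝ hv (by simpa using h1)
  have hc : ∀ t ∈ energyRange T, κ.c₁ t = -κ.a₁ t ^ 2 * κ.c₂ t := by
    intro t ht
    obtain ⟨z, hz, rfl, v, hv, hvy, hpos⟩ := hpt t ht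
    have h1 := h.formV_opH_opH hz v v
    rw [formV, formH, opH, natEnd_apply_orthogonal hvy, natForm_apply, natForm_apply] at h1
    simp only [map_smul, smul_apply, smul_eq_mul, hvy] at h1
    refine mul_right_cancel₀ hpos.ne' ?_
    linear_combination h1
  refine ⟨h.smooth, hmul, ?_, hc, ?_⟩
  · intro t ht
    rcases ht.1.eq_or_lt with rfl | h0
    · simpa using left_ne_zero_of_mul (a := κ.a₁ 0) (b := κ.a₂ 0)
        (by rw [hmul 0 ht]; exact one_ne_zero)
    · obtain ⟨z, hz, rfl, -⟩ := hpt t ht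
      intro hα
      have h1 := h.opV_opH hz z.2
      rw [opH, natEnd_apply_self, hα, zero_smul, map_zero] at h1
      have := metric_self_eq_energy (γ := γ) z
      rw [← h1, map_zero] at this
      linarith
  · intro t ht
    rcases ht.1.eq_or_lt with rfl | h0
    · simpa using hc 0 ht
    · obtain ⟨z, hz, rfl, -⟩ := hpt t ht
      have h1 := h.formV_opH_opH hz z.2 z.2
      rw [formV, formH, opH, natEnd_apply_self, natForm_apply, natForm_apply] at h1
      simp only [map_smul, smul_apply, smul_eq_mul, metric_self_eq_energy] at h1
      refine mul_right_cancel₀ (b := 2 * energy γ z) (by positivity) ?_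
      linear_combination h1

variable [FiniteDimensional ℝ E]

/-- The Nijenhuis tensor vanishes iff `R(X, Y) y = f(t) (g(Y, y) X - g(X, y) Y)`. -/
theorem nijenhuis_eq_zero_iff_curvature (h : IsNorden γ κ U T) (hz : z ∈ tube γ U T) :
    (∀ u v, nijenhuis (liftJ γ κ) z u v = 0) ↔ ∀ X Y, curvature γ z.1 X Y z.2 =
      curvatureFun κ T (energy γ z) • (γ z.1 Y z.2 • X - γ z.1 X z.2 • Y) := by
  rw [h.nijenhuis_eq_zero_iff hz]
  refine forall₂_congr fun X Y => ?_
  rw [h.metric.opHDeriv_opH_sub hz.1, neg_add_eq_zero, eq_comm]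

end IsNorden

theorem IsMetricOn.curvature_smul [FiniteDimensional ℝ E] (hγ : IsMetricOn γ U) (hx : x ∈ U)
    (u v w : E) (s : ℝ) : curvature γ x u v (s • w) = s • curvature γ x u v w := by
  simp only [hγ.curvature_eq hx, map_smul, smul_sub]

theorem continuousOn_curvatureFun (hT : 0 < T) (hκ : κ.SmoothOn (energyRange T)) :
    ContinuousOn (curvatureFun κ T) (energyRange T) := by
  have ha := hκ.1.1.continuousOn
  have ha' := continuousOn_derivWithin_energyRange hT hκ.1.1
  have hb := hκ.2.1.1.continuousOn
  exact (ha.mul ha').sub (hb.mul (ha.sub ((continuousOn_id.const_mul 2).mul ha')))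

namespace IsNorden

variable [FiniteDimensional ℝ E]

/-- With `v` orthogonal to `y`, replacing the fibre vector `y` by `s y` multiplies the left side of
`hR` by `s`, so `f(s² t) = f(t)` for `0 < s ≤ 1`. Continuity covers `0`. -/
theorem curvatureFun_eq (h : IsNorden γ κ U T) (hT : 0 < T) (hx : x ∈ U)
    (hE : 2 ≤ Module.finrank ℝ E)
    (hR : ∀ z ∈ tube γ U T, ∀ X Y, curvature γ z.1 X Y z.2 =
      curvatureFun κ T (energy γ z) • (γ z.1 Y z.2 • X - γ z.1 X z.2 • Y))
    {t : ℝ} (ht : t ∈ energyRange T) : curvatureFun κ T t = curvatureFun κ T 0 := by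
  have hγ := h.metric
  rcases ht.1.eq_or_lt with rfl | h0
  · rfl
  obtain ⟨y, v, hy, hv, hyv⟩ := hγ.exists_energy_eq_and_orthogonal hx hE ht.1
  rw [hγ.symm x hx] at hyv
  have hyy : γ x y y = 2 * t := by rw [← hy]; exact metric_self_eq_energy (γ := γ) (x, y)
  have hsub := energyRange_Icc_subset ht
  have hval : ∀ s : ℝ, 0 < s → s ^ 2 * t ≤ t →
      curvature γ x v y y = (curvatureFun κ T (s ^ 2 * t) * (2 * t)) • v := by
    intro s hs hst
    have hmem : s ^ 2 * t ∈ energyRange T := hsub ⟨by positivity, hst⟩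
    have hen : energy γ (x, s • y) = s ^ 2 * t := by rw [energy_smul, hy]
    have h1 := hR (x, s • y) ⟨hx, by rw [hen]; exact hmem.2⟩ v y
    simp only [hen, hγ.curvature_smul hx, map_smul, hyv, hyy, smul_eq_mul, mul_zero,
      zero_smul, sub_zero] at h1
    refine smul_right_injective E hs.ne' ?_
    simp only [h1]
    module
  have hconst : Set.EqOn (curvatureFun κ T) (fun _ => curvatureFun κ T t) (Set.Ioc 0 t) := by
    intro r hr
    have hs : Real.sqrt (r / t) ^ 2 * t = r := by
      rw [Real.sq_sqrt (div_nonneg hr.1.le h0.le)]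
      field_simp
    have h1 := hval (Real.sqrt (r / t)) (Real.sqrt_pos.2 (div_pos hr.1 h0)) (by rw [hs]; exact hr.2)
    have h2 := hval 1 one_pos (by simp)
    rw [hs, h2] at h1
    have h3 := smul_left_injective ℝ hv h1
    simp only [one_pow, one_mul] at h3
    exact (mul_right_cancel₀ (by positivity) h3).symm
  have := hconst.of_subset_closure ((continuousOn_curvatureFun hT h.smooth).mono hsub)
    continuousOn_const Set.Ioc_subset_Icc_self (by rw [closure_Ioc h0.ne])
  exact (this ⟨le_rfl, h0.le⟩).symm

/-- Both sides are homogeneous in `w`, so a nonzero `w` may be rescaled into the tube. -/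
theorem curvature_eq (h : IsNorden γ κ U T) (hT : 0 < T) (hx : x ∈ U)
    (hE : 2 ≤ Module.finrank ℝ E)
    (hR : ∀ z ∈ tube γ U T, ∀ X Y, curvature γ z.1 X Y z.2 =
      curvatureFun κ T (energy γ z) • (γ z.1 Y z.2 • X - γ z.1 X z.2 • Y)) (u v w : E) :
    curvature γ x u v w = curvatureFun κ T 0 • (γ x v w • u - γ x u w • v) := by
  have hγ := h.metric
  by_cases hw : w = 0
  · have := hγ.curvature_smul hx u v w 0
    simpa [hw] using this
  obtain ⟨r, hr, hr0⟩ := exists_pos_mem_energyRange hT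
  obtain ⟨s, hs⟩ := hγ.exists_energy_smul_eq hx hw hr.1
  have hs0 : s ≠ 0 := by
    rintro rfl
    rw [energy_smul] at hs
    simp at hs
    exact hr0.ne hs
  have h1 := hR (x, s • w) ⟨hx, by rw [hs]; exact hr.2⟩ u v
  rw [hs, h.curvatureFun_eq hT hx hE hR hr] at h1
  simp only [hγ.curvature_smul hx, map_smul, smul_eq_mul] at h1
  refine smul_right_injective E hs0 ?_
  simp only [h1]
  module

/-- Necessity of the equations for the metric coefficients. -/
theorem metric_equations (h : IsNorden γ κ U T) (hT : 0 < T) (hx : x ∈ U)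
    (hE : 2 ≤ Module.finrank ℝ E) {c : ℝ}
    (hR : ∀ x ∈ U, ∀ u v w, curvature γ x u v w = c • (γ x v w • u - γ x u w • v))
    (hcov : ∀ z ∈ tube γ U T, ∀ u v, covDerivEnd (liftG γ κ) (liftJ γ κ) z u v = 0) :
    ∀ t ∈ energyRange T,
      (κ.a₁ t + 2 * t * κ.b₁ t) * derivWithin κ.c₁ (energyRange T) t + κ.a₁ t * κ.d₁ t
        + c * κ.c₂ t * κ.a₁ t = 0 ∧ κ.d₁ t = c * κ.c₂ t := by
  have hγ := h.metric
  have hκ := h.coeffs hx hE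
  have key : ∀ t ∈ energyRange T, 0 < t →
      (κ.a₁ t + 2 * t * κ.b₁ t) * derivWithin κ.c₁ (energyRange T) t + κ.a₁ t * κ.d₁ t
        + c * κ.c₂ t * κ.a₁ t = 0 ∧ κ.d₁ t = c * κ.c₂ t := by
    intro t ht h0
    obtain ⟨y, v, hy, hv, hyv⟩ := hγ.exists_energy_eq_and_orthogonal hx hE ht.1
    have hz : (x, y) ∈ tube γ U T := ⟨hx, by rw [hy]; exact ht.2⟩
    have hvy : γ x v y = 0 := by rw [hγ.symm x hx, hyv]
    have hyy : γ x y y = 2 * t := by rw [← hy]; exact metric_self_eq_energy (γ := γ) (x, y)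
    have hvv := (hγ.pos x hx v hv).ne'
    have heq := ((h.covDerivEnd_eq_zero_iff hz).1 (hcov _ hz)).1
    have hform := hγ.horizontal_equation (z := (x, y)) (κ := κ) (T := T) hx
      (fun X Y => hR x hx X Y y) hy rfl rfl rfl rfl rfl rfl
    constructor
    -- With `v` orthogonal to `y`, the triple `(v, y, v)` isolates the first coefficient and `(y, v,
    -- v)` the second.
    · have h1 := (hform v y v).symm.trans (heq v y v)
      simp only [hvy, hyv, hyy, mul_zero, zero_mul, add_zero] at h1
      exact (mul_eq_zero.1 h1).resolve_right (by positivity)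
    · have h1 := (hform y v v).symm.trans (heq y v v)
      simp only [hvy, hyv, hyy, mul_zero, add_zero, zero_add] at h1
      have h2 := (mul_eq_zero.1 ((mul_eq_zero.1 h1).resolve_right hvv)).resolve_right
        (by positivity)
      have h3 := (mul_eq_zero.1 h2).resolve_left (mul_ne_zero two_ne_zero (hκ.a₁_ne_zero ht))
      linarith
  obtain ⟨⟨ha, -⟩, ⟨hb, -⟩, ⟨hc₁, hc₂⟩, ⟨hd, -⟩⟩ := h.smooth
  have hc₁' := continuousOn_derivWithin_energyRange hT hc₁
  replace ha := ha.continuousOn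
  replace hb := hb.continuousOn
  replace hc₂ := hc₂.continuousOn
  replace hd := hd.continuousOn
  intro t ht
  exact ⟨eqOn_energyRange_of_pos hT
    (f := fun t => (κ.a₁ t + 2 * t * κ.b₁ t) * derivWithin κ.c₁ (energyRange T) t
      + κ.a₁ t * κ.d₁ t + c * κ.c₂ t * κ.a₁ t) (g := fun _ => 0)
    ((((ha.add ((continuousOn_id.const_mul 2).mul hb)).mul hc₁').add (ha.mul hd)).add
      ((hc₂.const_mul c).mul ha)) continuousOn_const (fun t ht h0 => (key t ht h0).1) ht,
    eqOn_energyRange_of_pos hT hd (hc₂.const_mul c) (fun t ht h0 => (key t ht h0).2) ht⟩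

/-- Sufficiency of the equations for the metric coefficients. -/
theorem covDerivEnd_eq_zero (h : IsNorden γ κ U T) (hT : 0 < T)
    (hE : 2 ≤ Module.finrank ℝ E) {c : ℝ}
    (hR : ∀ x ∈ U, ∀ u v w, curvature γ x u v w = c • (γ x v w • u - γ x u w • v))
    (hf : ∀ t ∈ energyRange T, curvatureFun κ T t = c)
    (hm : ∀ t ∈ energyRange T,
      (κ.a₁ t + 2 * t * κ.b₁ t) * derivWithin κ.c₁ (energyRange T) t + κ.a₁ t * κ.d₁ t
        + c * κ.c₂ t * κ.a₁ t = 0 ∧ κ.d₁ t = c * κ.c₂ t) (hz : z ∈ tube γ U T) (u v : E × E) :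
    covDerivEnd (liftG γ κ) (liftJ γ κ) z u v = 0 := by
  have hγ := h.metric
  have hκ := h.coeffs hz.1 hE
  have ht := hγ.energy_mem hz
  obtain ⟨hm1, hm2⟩ := hm _ ht
  obtain ⟨hc₂', hd₁'⟩ := hκ.deriv_relations hT hf hm ht
  revert u v
  rw [h.covDerivEnd_eq_zero_iff hz]
  constructor
  · intro X Y Z
    rw [hγ.horizontal_equation hz.1 (fun X Y => hR _ hz.1 X Y z.2) rfl rfl rfl rfl rfl rfl rfl,
      hm1, hd₁', hm2]
    linear_combination (2 * c * (γ z.1 X z.2 * γ z.1 Y z.2 * γ z.1 Z z.2)) * hc₂'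
  · intro X Y Z
    rw [← h.opH_opV hz X,
      hγ.vertical_equation hz.1 (fun X Y => hR _ hz.1 X Y z.2) rfl rfl rfl rfl rfl rfl]
    -- On the zero section both tensor terms contain `y = 0`. Elsewhere the radial relation, divided
    -- by `2 t`, supplies the needed information on `d₂`.
    rcases ht.1.eq_or_lt with h0 | h0
    · have hy : z.2 = 0 := by
        by_contra hy
        exact (hγ.energy_pos hz.1 hy).ne h0
      simp [hy]
    · have hc₁ := hκ.c₁_eq _ ht
      have hrad := hκ.radial_eq _ ht
      set t := energy γ z
      refine mul_eq_zero_of_left (mul_left_cancel₀ (mul_ne_zero two_ne_zero h0.ne') ?_) _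
      rw [hm2, hc₁] at hrad
      linear_combination (-2 * t * κ.a₁ t ^ 2) * hc₂' + (κ.a₁ t) * hrad

end IsNorden

end

/-! ### The metric of `M` in a chart -/

section
variable {n : ℕ} {M : Type*} [TopologicalSpace M] [ChartedSpace (EuclideanSpace ℝ (Fin n)) M]
  [IsManifold (𝓡 n) ∞ M]
  (g : Bundle.ContMDiffRiemannianMetric (𝓡 n) ∞ (EuclideanSpace ℝ (Fin n))
    (TangentSpace (𝓡 n) : M → Type))
  {e : OpenPartialHomeomorph M (EuclideanSpace ℝ (Fin n))}

/-- The field is the tangent map of `e.symm` composed with a constant section. -/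
theorem contMDiffOn_mfderiv_symm_apply (he : e ∈ IsManifold.maximalAtlas (𝓡 n) ∞ M)
    (v : EuclideanSpace ℝ (Fin n)) :
    ContMDiffOn (𝓡 n) (𝓡 n).tangent ∞ (fun x => (⟨e.symm x, mfderiv (𝓡 n) (𝓡 n) e.symm x v⟩ :
      TangentBundle (𝓡 n) M)) e.target := by
  have h0 : ContMDiffOn (𝓡 n) (𝓡 n) ∞ e.symm e.target :=
    contMDiffOn_symm_of_mem_maximalAtlas he
  have : IsManifold (𝓡 n) 1 M := IsManifold.of_le (m := 1) (n := ∞) (by simp)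
  have h1 := h0.contMDiffOn_tangentMapWithin (m := ∞) (by simp) e.open_target.uniqueMDiffOn
  have h2 : ContMDiff (𝓡 n) (𝓡 n).tangent ∞ (fun x : EuclideanSpace ℝ (Fin n) =>
      (⟨x, v⟩ : TangentBundle (𝓡 n) (EuclideanSpace ℝ (Fin n)))) := by
    exact contMDiff_vectorSpace_iff_contDiff.2 contDiff_const
  refine (h1.comp h2.contMDiffOn (fun x hx => hx)).congr fun x hx => ?_
  simp only [Function.comp_def, tangentMapWithin]
  rw [mfderivWithin_of_isOpen e.open_target hx]

omit [IsManifold (𝓡 n) ∞ M] in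
theorem mdifferentiable_of_mem_maximalAtlas_infty
    (he : e ∈ IsManifold.maximalAtlas (𝓡 n) ∞ M) : e.MDifferentiable (𝓡 n) (𝓡 n) :=
  ⟨(contMDiffOn_of_mem_maximalAtlas he).mdifferentiableOn (by simp),
    (contMDiffOn_symm_of_mem_maximalAtlas he).mdifferentiableOn (by simp)⟩

theorem isMetricOn_chartMetric (he : e ∈ IsManifold.maximalAtlas (𝓡 n) ∞ M) :
    IsMetricOn (chartMetric g e) e.target where
  isOpen := e.open_target
  smooth := by
    rw [contDiffOn_clm_apply]
    intro u
    rw [contDiffOn_clm_apply]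
    intro v
    have h0 : ContMDiffOn (𝓡 n) (𝓡 n) ∞ e.symm e.target :=
      contMDiffOn_symm_of_mem_maximalAtlas he
    have := ContMDiffOn.clm_bundle_apply₂
      (F₁ := EuclideanSpace ℝ (Fin n)) (F₂ := EuclideanSpace ℝ (Fin n)) (F₃ := ℝ)
      (E₁ := (TangentSpace (𝓡 n) : M → Type)) (E₂ := (TangentSpace (𝓡 n) : M → Type))
      (E₃ := Bundle.Trivial M ℝ) (ψ := fun x => g.inner (e.symm x))
      (g.contMDiff.comp_contMDiffOn h0)
      (contMDiffOn_mfderiv_symm_apply he u) (contMDiffOn_mfderiv_symm_apply he v)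
    intro x hx
    have h := this x hx
    have h' := (Bundle.contMDiffWithinAt_totalSpace.1 h).2
    rw [contMDiffWithinAt_iff_contDiffWithinAt] at h'
    exact h'
  symm x hx u v := g.symm _ _ _
  pos x hx v hv := by
    have hx' := ((mdifferentiable_of_mem_maximalAtlas_infty he).symm).mfderiv_injective
      (x := x) (by simpa using hx)
    have h0 : mfderiv (𝓡 n) (𝓡 n) e.symm x v ≠ 0 := fun h0 => hv (hx' (h0.trans (map_zero _).symm))
    exact g.pos (e.symm x) _ h0

end

/-! ### Global criteria on the manifold -/

section

variable {n : ℕ} {M : Type*} [TopologicalSpace M] [ChartedSpace (EuclideanSpace ℝ (Fin n)) M]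
  [IsManifold (𝓡 n) ∞ M]
  {g : Bundle.ContMDiffRiemannianMetric (𝓡 n) ∞ (EuclideanSpace ℝ (Fin n))
    (TangentSpace (𝓡 n) : M → Type)}
  {e : OpenPartialHomeomorph M (EuclideanSpace ℝ (Fin n))} {T : EReal} {κ : DiagonalCoeffs}

theorem IsAntiHermitian.smoothOn (h : IsAntiHermitian g T κ) : κ.SmoothOn (energyRange T) :=
  ⟨⟨h.smooth_a₁, h.smooth_a₂⟩, ⟨h.smooth_b₁, h.smooth_b₂⟩, ⟨h.smooth_c₁, h.smooth_c₂⟩,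
    ⟨h.smooth_d₁, h.smooth_d₂⟩⟩

theorem IsAntiHermitian.isNorden (h : IsAntiHermitian g T κ)
    (he : e ∈ IsManifold.maximalAtlas (𝓡 n) ∞ M) : IsNorden (chartMetric g e) κ e.target T :=
  ⟨isMetricOn_chartMetric g he, h.smoothOn, h.almostComplex e he, h.nondegenerate e he,
    h.antiHermitian e he⟩

variable (n M) in
theorem exists_mem_maximalAtlas_target [Nonempty M] :
    ∃ e ∈ IsManifold.maximalAtlas (𝓡 n) ∞ M, ∃ x : EuclideanSpace ℝ (Fin n), x ∈ e.target := by
  obtain ⟨p⟩ := ‹Nonempty M›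
  exact ⟨chartAt _ p, IsManifold.chart_mem_maximalAtlas p, chartAt _ p p,
    (chartAt _ p).map_source (mem_chart_source _ p)⟩

theorem two_le_finrank (hn : 2 ≤ n) : 2 ≤ Module.finrank ℝ (EuclideanSpace ℝ (Fin n)) := by
  rwa [finrank_euclideanSpace_fin]

theorem IsAntiHermitian.coeffs [Nonempty M] (h : IsAntiHermitian g T κ) (hn : 2 ≤ n) :
    κ.IsNorden T := by
  obtain ⟨e, he, x, hx⟩ := exists_mem_maximalAtlas_target n M
  exact (h.isNorden he).coeffs hx (two_le_finrank hn)

theorem IsAntiHermitian.isIntegrable_iff [Nonempty M] (h : IsAntiHermitian g T κ) (hn : 2 ≤ n)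
    (hT : 0 < T) : IsIntegrable g T κ ↔
      ∃ c : ℝ, HasConstantCurvature g c ∧ IntegrabilityFormula T κ c := by
  have hκ := h.coeffs hn
  have hE := two_le_finrank hn
  constructor
  · intro hN
    have hR : ∀ e ∈ IsManifold.maximalAtlas (𝓡 n) ∞ M, ∀ z ∈ tube (chartMetric g e) e.target T,
        ∀ X Y, curvature (chartMetric g e) z.1 X Y z.2 =
          curvatureFun κ T (energy (chartMetric g e) z) •
            (chartMetric g e z.1 Y z.2 • X - chartMetric g e z.1 X z.2 • Y) :=
      fun e he z hz => ((h.isNorden he).nijenhuis_eq_zero_iff_curvature hz).1 (hN e he z hz)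
    -- The constant is read off from the coefficients alone, so all charts share it, even if `M` is
    -- disconnected.
    refine ⟨curvatureFun κ T 0, fun e he x hx u v w =>
      (h.isNorden he).curvature_eq hT hx hE (hR e he) u v w, ?_⟩
    obtain ⟨e, he, x, hx⟩ := exists_mem_maximalAtlas_target n M
    exact integrabilityFormula_of_curvatureFun_eq h.smoothOn (fun t ht => hκ.a₁_ne_zero ht)
      hκ.radial_ne_zero fun t ht => (h.isNorden he).curvatureFun_eq hT hx hE (hR e he) ht
  · rintro ⟨c, hc, hf⟩ e he z hz
    refine ((h.isNorden he).nijenhuis_eq_zero_iff_curvature hz).2 fun X Y => ?_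
    rw [hf.curvatureFun_eq ((isMetricOn_chartMetric g he).energy_mem hz)]
    exact hc e he z.1 hz.1 X Y z.2

/-- Integrability comes first: it yields the space form on which the metric equations are then
tested. -/
theorem IsAntiHermitian.isAntiKahler_iff [Nonempty M] (h : IsAntiHermitian g T κ) (hn : 2 ≤ n)
    (hT : 0 < T) : IsAntiKahler g T κ ↔ ∃ c : ℝ, HasConstantCurvature g c ∧
      IntegrabilityFormula T κ c ∧ MetricFormulas T κ c := by
  have hκ := h.coeffs hn
  have hE := two_le_finrank hn
  constructor
  · intro hcov
    have hN : IsIntegrable g T κ := fun e he z hz =>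
      (h.isNorden he).nijenhuis_eq_zero hz (hcov e he z hz)
    obtain ⟨c, hc, hf⟩ := (h.isIntegrable_iff hn hT).1 hN
    obtain ⟨e, he, x, hx⟩ := exists_mem_maximalAtlas_target n M
    exact ⟨c, hc, hf, (hκ.metricFormulas_iff fun t ht => hf.curvatureFun_eq ht).2
      ((h.isNorden he).metric_equations hT hx hE (hc e he) (hcov e he))⟩
  · rintro ⟨c, hc, hf, hm⟩ e he z hz
    have hf' : ∀ t ∈ energyRange T, curvatureFun κ T t = c := fun t ht => hf.curvatureFun_eq ht
    exact (h.isNorden he).covDerivEnd_eq_zero hT hE (hc e he) hf'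
      ((hκ.metricFormulas_iff hf').1 hm) hz

end

/-! ### The special family -/

section Special

variable {T : EReal} {κ : DiagonalCoeffs} {c A B : ℝ}

/-- `Real.sqrt` is zero at nonpositive arguments, whereas `a₁` never vanishes because `J` is
invertible. -/
theorem SpecialCoeffs.pos (h : SpecialCoeffs T κ c A B) (hκ : κ.IsNorden T) {t : ℝ}
    (ht : t ∈ energyRange T) : 0 < B + 2 * c * t := by
  have := hκ.a₁_ne_zero ht
  rw [(h t ht).1] at this
  exact Real.sqrt_ne_zero'.1 this

theorem SpecialCoeffs.deriv_a₁ (h : SpecialCoeffs T κ c A B) (hκ : κ.IsNorden T) (hT : 0 < T)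
    {t : ℝ} (ht : t ∈ energyRange T) :
    κ.a₁ t * derivWithin κ.a₁ (energyRange T) t = c := by
  have hpos := h.pos hκ ht
  have h1 : HasDerivAt (fun t : ℝ => B + 2 * c * t) (2 * c) t := by
    simpa using ((hasDerivAt_id t).const_mul (2 * c)).const_add B
  have h2 := ((h1.sqrt hpos.ne').hasDerivWithinAt.congr (s := energyRange T)
    (fun s hs => (h s hs).1) (h t ht).1).derivWithin (uniqueDiffOn_energyRange hT t ht)
  rw [h2, (h t ht).1]
  have := (Real.sqrt_pos.2 hpos).ne'
  field_simp

theorem SpecialCoeffs.integrabilityFormula (h : SpecialCoeffs T κ c A B) (hκ : κ.IsNorden T)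
    (hT : 0 < T) (hB : 0 < B) : IntegrabilityFormula T κ c := by
  intro t ht
  have hd := h.deriv_a₁ hκ hT ht
  have hsq : κ.a₁ t ^ 2 = B + 2 * c * t := by
    rw [(h t ht).1, Real.sq_sqrt (h.pos hκ ht).le]
  -- The denominator is nonzero since `a₁ (a₁ - 2 t a₁') = (B + 2 c t) - 2 c t = B`.
  refine ⟨fun h0 => hB.ne' ?_, ?_⟩
  · linear_combination κ.a₁ t * h0 + 2 * t * hd - hsq
  · rw [hd, sub_self, zero_div, (h t ht).2.1]

theorem SpecialCoeffs.metricFormulas (h : SpecialCoeffs T κ c A B) (hκ : κ.IsNorden T)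
    (hT : 0 < T) (hB : 0 < B) : MetricFormulas T κ c := by
  rw [hκ.metricFormulas_iff fun t ht => (h.integrabilityFormula hκ hT hB).curvatureFun_eq ht]
  intro t ht
  obtain ⟨ha, hb, hc, hd⟩ := h t ht
  have hpos := h.pos hκ ht
  have hsq : κ.a₁ t ^ 2 = B + 2 * c * t := by rw [ha, Real.sq_sqrt hpos.le]
  have hc₂ : κ.c₂ t = -A := by
    have := hκ.c₁_eq t ht
    rw [hsq, hc] at this
    refine mul_left_cancel₀ hpos.ne' ?_
    linear_combination this
  have h1 : HasDerivAt (fun t : ℝ => A * (B + 2 * c * t)) (A * (2 * c)) t := by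
    simpa using (((hasDerivAt_id t).const_mul (2 * c)).const_add B).const_mul A
  have h2 := (h1.hasDerivWithinAt.congr (s := energyRange T)
    (fun s hs => (h s hs).2.2.1) hc).derivWithin (uniqueDiffOn_energyRange hT t ht)
  rw [h2, hb, hd, hc₂]
  constructor <;> ring

/-- The coefficients of the special family of anti-Kähler structures. -/
def specialCoeffs (c A B : ℝ) : DiagonalCoeffs where
  a₁ t := Real.sqrt (B + 2 * c * t)
  a₂ t := (Real.sqrt (B + 2 * c * t))⁻¹
  b₁ _ := 0
  b₂ _ := 0
  c₁ t := A * (B + 2 * c * t)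
  c₂ _ := -A
  d₁ _ := -c * A
  d₂ t := c * A / (B + 2 * c * t)

theorem specialCoeffs_smoothOn (hpos : ∀ t ∈ energyRange T, 0 < B + 2 * c * t) :
    (specialCoeffs c A B).SmoothOn (energyRange T) := by
  have h1 : ContDiffOn ℝ ∞ (fun t : ℝ => B + 2 * c * t) (energyRange T) := by fun_prop
  have h2 := h1.sqrt fun t ht => (hpos t ht).ne'
  exact ⟨⟨h2, h2.inv fun t ht => (Real.sqrt_pos.2 (hpos t ht)).ne'⟩,
    ⟨contDiffOn_const, contDiffOn_const⟩, ⟨contDiffOn_const.mul h1, contDiffOn_const⟩,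
    ⟨contDiffOn_const, contDiffOn_const.div h1 fun t ht => (hpos t ht).ne'⟩⟩

variable {E : Type*} [NormedAddCommGroup E] [NormedSpace ℝ E]
  {γ : E → E →L[ℝ] E →L[ℝ] ℝ} {U : Set E} {z : E × E}

/-- `natForm` is nondegenerate if both of its eigenvalues with respect to `γ` are nonzero. -/
theorem IsMetricOn.eq_zero_of_natForm (hγ : IsMetricOn γ U) (hz : z.1 ∈ U) {α β : ℝ} (hα : α ≠ 0)
    (hβ : α + 2 * energy γ z * β ≠ 0) {X : E} (h : ∀ Y, natForm γ z α β X Y = 0) : X = 0 := by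
  have hXy : γ z.1 X z.2 = 0 := by
    have := h z.2
    rw [natForm_apply, metric_self_eq_energy] at this
    refine (mul_eq_zero.1 (?_ : (α + 2 * energy γ z * β) * γ z.1 X z.2 = 0)).resolve_left hβ
    linear_combination this
  refine hγ.nondegenerate hz X fun Y => ?_
  have := h Y
  rw [natForm_apply, hXy, zero_mul, mul_zero, add_zero] at this
  exact (mul_eq_zero.1 this).resolve_left hα

/-- `J` is a pure rescaling between the two lifts. The value of `d₂` is the one forced by `G(JX, JY)
= -G(X, Y)`; the radial eigenvalues of `G` are then `A B` and `-A B / (B + 2 c t)`, both nonzero. -/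
theorem isNorden_specialCoeffs (hγ : IsMetricOn γ U) (hA : A ≠ 0) (hB : 0 < B)
    (hpos : ∀ t ∈ energyRange T, 0 < B + 2 * c * t) : IsNorden γ (specialCoeffs c A B) U T := by
  have hJ1 : ∀ z, ∀ X, natEnd γ z ((specialCoeffs c A B).a₁ (energy γ z))
      ((specialCoeffs c A B).b₁ (energy γ z)) X = Real.sqrt (B + 2 * c * energy γ z) • X := by
    intro z X
    simp [natEnd_apply, specialCoeffs]
  have hJ2 : ∀ z, ∀ X, natEnd γ z ((specialCoeffs c A B).a₂ (energy γ z))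
      ((specialCoeffs c A B).b₂ (energy γ z)) X = (Real.sqrt (B + 2 * c * energy γ z))⁻¹ • X := by
    intro z X
    simp [natEnd_apply, specialCoeffs]
  refine ⟨hγ, specialCoeffs_smoothOn hpos, fun z hz w => ?_, fun z hz w hw => ?_,
    fun z hz w w' => ?_⟩
  · have hs := (Real.sqrt_pos.2 (hpos _ (hγ.energy_mem hz))).ne'
    rw [liftJ_apply (liftJ γ _ z w), vertPart_liftJ, liftJ_fst]
    simp only [hJ1, hJ2, smul_neg, smul_smul, mul_inv_cancel₀ hs,
      inv_mul_cancel₀ hs, one_smul, vertPart_apply]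
    ext <;> simp
  · have hp := hpos _ (hγ.energy_mem hz)
    have hne : A * (B + 2 * c * energy γ z) ≠ 0 := mul_ne_zero hA hp.ne'
    have h1 : w.1 = 0 := by
      refine hγ.eq_zero_of_natForm (α := A * (B + 2 * c * energy γ z)) (β := -c * A) hz.1 hne
        ?_ fun Y => ?_
      · have : A * (B + 2 * c * energy γ z) + 2 * energy γ z * (-c * A) = A * B := by ring
        rw [this]
        exact mul_ne_zero hA hB.ne'
      · have := hw (horLift γ z Y)
        rw [liftG_apply, vertPart_horLift, map_zero, add_zero] at this
        exact this
    have h2 : vertPart γ z w = 0 := by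
      refine hγ.eq_zero_of_natForm (α := -A) (β := c * A / (B + 2 * c * energy γ z)) hz.1
        (neg_ne_zero.2 hA) ?_ fun Y => ?_
      · have : -A + 2 * energy γ z * (c * A / (B + 2 * c * energy γ z)) =
            -(A * B) / (B + 2 * c * energy γ z) := by
          have hd : c * A / (B + 2 * c * energy γ z) * (B + 2 * c * energy γ z) = c * A :=
            div_mul_cancel₀ _ hp.ne'
          rw [eq_div_iff hp.ne']
          linear_combination (2 * energy γ z) * hd
        rw [this]
        exact div_ne_zero (neg_ne_zero.2 (mul_ne_zero hA hB.ne')) hp.ne'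
      · have := hw (vertLift Y)
        rw [liftG_apply, vertPart_vertLift, vertLift_fst, map_zero, zero_add] at this
        exact this
    rw [← horLift_add_vertLift (γ := γ) (z := z) w, h1, h2, map_zero, map_zero, add_zero]
  · have hp := hpos _ (hγ.energy_mem hz)
    have hs := (Real.sqrt_pos.2 hp).ne'
    have hsq := Real.sq_sqrt hp.le
    simp only [liftG_apply, vertPart_liftJ, liftJ_fst, hJ1, hJ2, natForm_apply, map_neg, map_smul,
      neg_apply, smul_apply, smul_eq_mul]
    simp only [specialCoeffs]
    set r := Real.sqrt (B + 2 * c * energy γ z)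
    rw [← hsq]
    field_simp
    ring

theorem two_mul_pos_of_le (hB : 0 < B) (hTc : c < 0 → T ≤ ((-B / (2 * c) : ℝ) : EReal)) {t : ℝ}
    (ht : t ∈ energyRange T) : 0 < B + 2 * c * t := by
  rcases lt_or_ge c 0 with hc | hc
  · have h1 : t < -B / (2 * c) := by exact_mod_cast ht.2.trans_le (hTc hc)
    rw [lt_div_iff_of_neg (by linarith)] at h1
    linarith
  · have := mul_nonneg (mul_nonneg zero_le_two hc) ht.1
    linarith

end Special

end AntiKahler

end

theorem mainTheorem2 {n : ℕ} (hn : 2 ≤ n) {M : Type*} [TopologicalSpace M] [T2Space M]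
    [SecondCountableTopology M] [Nonempty M] [ChartedSpace (EuclideanSpace ℝ (Fin n)) M]
    [IsManifold (𝓡 n) ∞ M]
    (g : Bundle.ContMDiffRiemannianMetric (𝓡 n) ∞ (EuclideanSpace ℝ (Fin n))
      (TangentSpace (𝓡 n) : M → Type)) :
    (∀ (T : EReal) (κ : AntiKahler.DiagonalCoeffs), 0 < T → AntiKahler.IsAntiHermitian g T κ →
      (AntiKahler.IsAntiKahler g T κ ↔
        (AntiKahler.IsIntegrable g T κ ∧
          ∃ c : ℝ, AntiKahler.HasConstantCurvature g c ∧
            AntiKahler.IntegrabilityFormula T κ c ∧ AntiKahler.MetricFormulas T κ c) ∨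
        (∃ c A B : ℝ, AntiKahler.HasConstantCurvature g c ∧ A ≠ 0 ∧ 0 < B ∧
          AntiKahler.SpecialCoeffs T κ c A B)) ∧
      (AntiKahler.IsIntegrable g T κ ↔
        ∃ c : ℝ, AntiKahler.HasConstantCurvature g c ∧
          AntiKahler.IntegrabilityFormula T κ c)) ∧
    (∀ c A B : ℝ, AntiKahler.HasConstantCurvature g c → A ≠ 0 → 0 < B →
      ∀ T : EReal, 0 < T →
        ((∃ κ : AntiKahler.DiagonalCoeffs, AntiKahler.IsAntiHermitian g T κ ∧
            AntiKahler.IsAntiKahler g T κ ∧ AntiKahler.SpecialCoeffs T κ c A B) ↔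
          (c < 0 → T ≤ ((-B / (2 * c) : ℝ) : EReal)))) := by
  refine ⟨fun T κ hT h => ⟨⟨fun hK => ?_, ?_⟩, h.isIntegrable_iff hn hT⟩,
    fun c A B hc hA hB T hT => ⟨?_, fun hTc => ?_⟩⟩
  · obtain ⟨c, hc, hf, hm⟩ := (h.isAntiKahler_iff hn hT).1 hK
    exact Or.inl ⟨(h.isIntegrable_iff hn hT).2 ⟨c, hc, hf⟩, c, hc, hf, hm⟩
  -- The second alternative is a subfamily of the first, so both reduce to the same criterion.
  · rintro (⟨-, hK⟩ | ⟨c, A, B, hc, -, hB, hs⟩)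
    · exact (h.isAntiKahler_iff hn hT).2 hK
    · have hκ := h.coeffs hn
      exact (h.isAntiKahler_iff hn hT).2
        ⟨c, hc, hs.integrabilityFormula hκ hT hB, hs.metricFormulas hκ hT hB⟩
  · rintro ⟨κ, h, -, hs⟩ hc0
    by_contra! hlt
    -- At `t = -B / (2 c)` the radicand `B + 2 c t` is zero, which `SpecialCoeffs.pos` excludes.
    have hmem : -B / (2 * c) ∈ AntiKahler.energyRange T :=
      ⟨div_nonneg_of_nonpos (by linarith) (by linarith), hlt⟩
    have := hs.pos (h.coeffs hn) hmem
    rw [mul_div_cancel₀ _ (by linarith : 2 * c ≠ 0)] at this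
    simp at this
  · have hpos : ∀ t ∈ AntiKahler.energyRange T, 0 < B + 2 * c * t := fun t ht =>
      AntiKahler.two_mul_pos_of_le hB hTc ht
    have hN := fun e (he : e ∈ IsManifold.maximalAtlas (𝓡 n) ∞ M) =>
      AntiKahler.isNorden_specialCoeffs (AntiKahler.isMetricOn_chartMetric g he) hA hB hpos
    obtain ⟨⟨h1, h2⟩, ⟨h3, h4⟩, ⟨h5, h6⟩, ⟨h7, h8⟩⟩ :=
      AntiKahler.specialCoeffs_smoothOn (A := A) hpos
    have h : AntiKahler.IsAntiHermitian g T (AntiKahler.specialCoeffs c A B) :=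
      ⟨h1, h2, h3, h4, h5, h6, h7, h8, fun e he => (hN e he).sq,
        fun e he => (hN e he).nondegenerate, fun e he => (hN e he).anti⟩
    have hs : AntiKahler.SpecialCoeffs T (AntiKahler.specialCoeffs c A B) c A B :=
      fun t _ => ⟨rfl, rfl, rfl, rfl⟩
    have hκ := h.coeffs hn
    exact ⟨_, h, (h.isAntiKahler_iff hn hT).2
      ⟨c, hc, hs.integrabilityFormula hκ hT hB, hs.metricFormulas hκ hT hB⟩, hs⟩
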